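/- Let $\mathbb F$ be a field with $\operatorname{char}\mathbb F\neq 2$ and let $A$ be a commutative, not necessarily associative or unital, $\mathbb F$-algebra. For $a\in A$ and $\mu\in\mathbb F$ put $A_\mu(a)=\{x\in A: ax=\mu x\}$. A *Jordan type half axis* of $A$ is a nonzero idempotent $a\in A$ such that $A=A_1(a)\oplus A_0(a)\oplus A_{1/2}(a)$ and $$A_1(a)A_1(a)\subseteq A_1(a),\quad A_1(a)A_0(a)=0,\quad A_0(a)A_0(a)\subseteq A_0(a),$$ $$A_1(a)A_{1/2}(a)\subseteq A_{1/2}(a),\quad A_0(a)A_{1/2}(a)\subseteq A_{1/2}(a),\quad A_{1/2}(a)A_{1/2}(a)\subseteq A_1(a)\oplus A_0(a);$$ it is *primitive* if $A_1(a)=\mathbb F a$. Let $(A,X)$ be a primitive axial algebra of Jordan type half, i.e. $X\subseteq A$ is a set of primitive Jordan type half axes generating $A$ as an algebra. For $a,b\in X$ let $\langle\langle a,b\rangle\rangle$ be the subalgebra generated by $a$ and $b$. It is called *solid* if every primitive idempotent $c$ of $\langle\langle a,b\rangle\rangle$ (a nonzero idempotent $c\in\langle\langle a,b\rangle\rangle$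 such that $x\in\langle\langle a,b\rangle\rangle$ and $cx=x$ imply $x\in\mathbb F c$) is a Jordan type half axis of $A$. Let $D_{a,b}\colon A\to A$, $D_{a,b}(x)=a(bx)-b(ax)$. Then for all $a,b\in X$: 1. if $D_{a,b}$ is a derivation of $A$, then $\langle\langle a,b\rangle\rangle$ is solid; 2. if $|\mathbb F|\neq 3$, then $\langle\langle a,b\rangle\rangle$ is solid if and only if $D_{a,b}$ is a derivation of $A$. -/

import Mathlib

namespace JordanHalf

section Definitions

variable (F : Type*) {A : Type*} [Field F] [NonUnitalNonAssocCommRing A] [Module F A]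
  [SMulCommClass F A A] [IsScalarTower F A A]

/-- The `μ`-eigenspace `A_μ(a)` of the multiplication operator `ad a : x ↦ a * x`. -/
def eig (a : A) (μ : F) : Submodule F A :=
  Module.End.eigenspace (LinearMap.mulLeft F a) μ

/-- `a` is an axis for the Jordan fusion law with parameter one half: a nonzero idempotent such
that `A` is the sum of the eigenspaces of `ad a` for the eigenvalues `1`, `0`, `1/2`, which
multiply according to
`1 ⋆ 1 = {1}`, `1 ⋆ 0 = ∅`, `0 ⋆ 0 = {0}`, `1 ⋆ 1/2 = 0 ⋆ 1/2 = {1/2}`, `1/2 ⋆ 1/2 = {1, 0}`. -/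
structure IsAxis (a : A) : Prop where
  ne_zero : a ≠ 0
  idem : a * a = a
  decomp : eig F a 1 ⊔ eig F a 0 ⊔ eig F a 2⁻¹ = ⊤
  one_one : ∀ x ∈ eig F a 1, ∀ y ∈ eig F a 1, x * y ∈ eig F a 1
  one_zero : ∀ x ∈ eig F a 1, ∀ y ∈ eig F a 0, x * y = 0
  zero_zero : ∀ x ∈ eig F a 0, ∀ y ∈ eig F a 0, x * y ∈ eig F a 0
  one_half : ∀ x ∈ eig F a 1, ∀ y ∈ eig F a 2⁻¹, x * y ∈ eig F a 2⁻¹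
  zero_half : ∀ x ∈ eig F a 0, ∀ y ∈ eig F a 2⁻¹, x * y ∈ eig F a 2⁻¹
  half_half : ∀ x ∈ eig F a 2⁻¹, ∀ y ∈ eig F a 2⁻¹, x * y ∈ eig F a 1 ⊔ eig F a 0

/-- A primitive axis: the `1`-eigenspace is the line spanned by the axis. -/
structure IsPrimitiveAxis (a : A) : Prop extends IsAxis F a where
  primitive : eig F a 1 = Submodule.span F {a}

/-- `(A, X)` is a primitive axial algebra of Jordan type half: `X` is a set of primitive axes
that generates `A` as a (nonunital, nonassociative) algebra. -/
structure IsPrimitiveAxialAlgebra (X : Set A) : Prop where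
  axis : ∀ a ∈ X, IsPrimitiveAxis F a
  generates : NonUnitalAlgebra.adjoin F X = ⊤

/-- The line `⟨⟨a, b⟩⟩`: the subalgebra generated by `a` and `b`. -/
def line (a b : A) : NonUnitalSubalgebra F A :=
  NonUnitalAlgebra.adjoin F {a, b}

variable {F} in
/-- `c` is a primitive idempotent of the subalgebra `B`: a nonzero idempotent of `B` whose
`1`-eigenspace within `B` is the line spanned by `c`. -/
structure IsPrimitiveIdempotentOf (B : NonUnitalSubalgebra F A) (c : A) : Prop where
  mem : c ∈ B
  ne_zero : c ≠ 0
  idem : c * c = c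
  primitive : ∀ x ∈ B, c * x = x → x ∈ Submodule.span F {c}

/-- The line `⟨⟨a, b⟩⟩` is solid: each of its primitive idempotents is an axis of the whole
algebra `A`. -/
def IsSolid (a b : A) : Prop :=
  ∀ c : A, IsPrimitiveIdempotentOf (line F a b) c → IsAxis F c

/-- The associator `D_{a,b} : x ↦ a * (b * x) - b * (a * x)`. -/
def D (a b : A) : A →ₗ[F] A :=
  LinearMap.mulLeft F a ∘ₗ LinearMap.mulLeft F b - LinearMap.mulLeft F b ∘ₗ LinearMap.mulLeft F a

variable {F} in
/-- A linear map is a derivation if it satisfies the Leibniz rule. -/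
def IsDerivation (d : A →ₗ[F] A) : Prop :=
  ∀ x y : A, d (x * y) = d x * y + x * d y

end Definitions

end JordanHalf

set_option linter.unusedSectionVars false
set_option linter.unnecessarySeqFocus false

namespace JordanHalf

/-! ### Axes, Miyamoto involutions and projection functionals. -/

section Axes

variable {F A : Type*} [Field F] [NonUnitalNonAssocCommRing A] [Module F A]
  [SMulCommClass F A A] [IsScalarTower F A A]

/-! A primitive axis `c` satisfies two identities of degree at most two in `c`: `2c(cx) = cx +
(c,x)c`, and multiplicativity of its Miyamoto involution `τ_c`. Here `(·,·)` is a Frobenius form,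
which exists because projection functionals are symmetric (`coord_comm`) and primitive axes span
`A`. Conversely, a nonzero idempotent satisfying both identities is an axis
(`AxisIdentities.isAxis`), so solidity concerns the zeros of quadratic polynomials on the line.

Write `b = αa + z + u` with `z`, `u` in the `0`- and `1/2`-eigenspaces of `a`, and `p = z - (1-α)a`.
All primitive idempotents of the line lie on the conic `αt² = s - (1-α)s²` of points `a + sp + tu`;
`a` is `(0,0)` and `b` is `(1,1)`. The vectors `D a` and `D b`, for `D = D_{a,b}`, are tangent to it
at these points. If `D` is a derivation, then, being skew for the form, it makes the identities
vanish to first order along these tangents. Together with the zeros `a`, `b` and `τ_a b`, this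
forces vanishing on the whole conic (`quadEval_eq_zero_on_conic`), and the line is solid.

Conversely, `D` is a derivation once the multiplicativity identity vanishes to first order at `a`
along `u` (`isDerivation_of_deriv`). Two pairs of zeros exchanged by `τ_a` suffice. One pair is `b`,
`τ_a b`; the other comes from `τ_b a` unless `2α = 1` or `4α = 1`. For `α = 1/2` the missing polar
condition is verified on joint eigenvectors of the orthogonal axes `a` and `τ_b a`. Solidity is used
only when `4α = 1`: it supplies the axis complementary to `a` if `α ≠ 1`. If `α = 1` (characteristic
3) it supplies a further point of the parabola `s = t²`, which is useful unless `F` has three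
elements. -/

lemma mem_eig {a x : A} {μ : F} : x ∈ eig F a μ ↔ a * x = μ • x := by
  simp [eig]

/-- Decomposition of an element into eigenvectors of an axis. -/
lemma IsAxis.exists_decomp {c : A} (h : IsAxis F c) (x : A) :
    ∃ p q r : A, x = p + q + r ∧ c * p = p ∧ c * q = 0 ∧ c * r = (2⁻¹ : F) • r := by
  have hx : x ∈ eig F c 1 ⊔ eig F c 0 ⊔ eig F c 2⁻¹ := by rw [h.decomp]; trivial
  obtain ⟨y, hy, r, hr, rfl⟩ := Submodule.mem_sup.1 hx
  obtain ⟨p, hp, q, hq, rfl⟩ := Submodule.mem_sup.1 hy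
  rw [mem_eig] at hp hq hr
  exact ⟨p, q, r, rfl, by simpa using hp, by simpa using hq, hr⟩

variable (F) in
/-- The Miyamoto map `1 - 8 L_c + 8 L_c ^ 2` attached to `c`. -/
def miyamoto (c : A) : A →ₗ[F] A :=
  LinearMap.id - (8 : F) • LinearMap.mulLeft F c
    + (8 : F) • (LinearMap.mulLeft F c ∘ₗ LinearMap.mulLeft F c)

lemma miyamoto_apply (c x : A) :
    miyamoto F c x = x - (8 : F) • (c * x) + (8 : F) • (c * (c * x)) := by
  simp [miyamoto]

/-- The polynomial `1 - 8λ + 8λ²` is `1` at `λ = 0, 1` and `-1` at `λ = 1/2`. -/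
lemma miyamoto_of_even {c p q : A} (hp : c * p = p) (hq : c * q = 0) :
    miyamoto F c (p + q) = p + q := by
  rw [miyamoto_apply, mul_add, hp, hq, add_zero, hp]; module

lemma miyamoto_of_half (h2 : (2 : F) ≠ 0) {c r : A} (hr : c * r = (2⁻¹ : F) • r) :
    miyamoto F c r = -r := by
  rw [miyamoto_apply, hr, mul_smul_comm, hr]
  match_scalars
  field_simp
  ring

lemma miyamoto_of_mem_sup {c x : A} (hx : x ∈ eig F c 1 ⊔ eig F c 0) : miyamoto F c x = x := by
  obtain ⟨p, hp, q, hq, rfl⟩ := Submodule.mem_sup.1 hx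
  rw [mem_eig] at hp hq
  exact miyamoto_of_even (by simpa using hp) (by simpa using hq)

lemma miyamoto_of_zero {c x : A} (hx : c * x = 0) : miyamoto F c x = x :=
  miyamoto_of_mem_sup (Submodule.mem_sup_right (mem_eig.2 (by simpa using hx)))

lemma IsAxis.exists_parity {c : A} (h : IsAxis F c) (x : A) :
    ∃ p q r : A, x = p + q + r ∧ p ∈ eig F c 1 ∧ q ∈ eig F c 0 ∧ r ∈ eig F c 2⁻¹ := by
  obtain ⟨p, q, r, hx, hp, hq, hr⟩ := h.exists_decomp x
  exact ⟨p, q, r, hx, mem_eig.2 (by simpa using hp), mem_eig.2 (by simpa using hq), mem_eig.2 hr⟩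

/-- The fusion law is a `ℤ/2`-grading with odd part the `1/2`-eigenspace, and the Miyamoto map is
the corresponding sign automorphism. -/
lemma IsAxis.miyamoto_mul (h2 : (2 : F) ≠ 0) {c : A} (h : IsAxis F c) (x y : A) :
    miyamoto F c (x * y) = miyamoto F c x * miyamoto F c y := by
  obtain ⟨p, q, r, rfl, hp, hq, hr⟩ := h.exists_parity x
  obtain ⟨p', q', r', rfl, hp', hq', hr'⟩ := h.exists_parity y
  have e1 {p q : A} (hp : p ∈ eig F c 1) (hq : q ∈ eig F c 0) : miyamoto F c (p + q) = p + q :=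
    miyamoto_of_mem_sup (Submodule.add_mem_sup hp hq)
  have e2 {r : A} (hr : r ∈ eig F c 2⁻¹) : miyamoto F c r = -r :=
    miyamoto_of_half h2 (mem_eig.1 hr)
  have m1 := e1 (h.one_one p hp p' hp') (h.zero_zero q hq q' hq')
  have m2 := miyamoto_of_mem_sup (h.half_half r hr r' hr')
  have m3 := e2 (h.one_half p hp r' hr')
  have m4 := e2 (h.zero_half q hq r' hr')
  have m5 := e2 (h.one_half p' hp' r hr)
  have m6 := e2 (h.zero_half q' hq' r hr)
  have z1 := h.one_zero p hp q' hq'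
  have z2 := h.one_zero p' hp' q hq
  have expand : (p + q + r) * (p' + q' + r')
      = (p * p' + q * q') + r * r' + p * r' + q * r' + p' * r + q' * r := by
    simp only [add_mul, mul_add, z1, mul_comm q p', z2, mul_comm r]
    abel
  rw [expand, map_add, map_add, map_add, map_add, map_add, m1, m2, m3, m4, m5, m6,
    map_add, map_add _ (p' + q'), e1 hp hq, e1 hp' hq', e2 hr, e2 hr']
  simp only [add_mul, mul_add, z1, mul_comm q p', z2, mul_comm r, neg_mul, mul_neg]
  abel

lemma IsAxis.miyamoto_miyamoto (h2 : (2 : F) ≠ 0) {c : A} (h : IsAxis F c) (x : A) :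
    miyamoto F c (miyamoto F c x) = x := by
  obtain ⟨p, q, r, rfl, hp, hq, hr⟩ := h.exists_decomp x
  rw [map_add, miyamoto_of_even hp hq, miyamoto_of_half h2 hr, map_add, miyamoto_of_even hp hq,
    map_neg, miyamoto_of_half h2 hr, neg_neg]

/-- A multiplicative involution carries primitive axes to primitive axes. -/
lemma IsPrimitiveAxis.map {T : A →ₗ[F] A} (hT : ∀ x y, T (x * y) = T x * T y)
    (hTT : ∀ x, T (T x) = x) {a : A} (h : IsPrimitiveAxis F a) : IsPrimitiveAxis F (T a) := by
  have key {x : A} {μ : F} : x ∈ eig F (T a) μ ↔ T x ∈ eig F a μ := by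
    rw [mem_eig, mem_eig]
    constructor <;> intro hx
    · have := congrArg T hx
      rwa [hT, hTT, map_smul] at this
    · have := congrArg T hx
      rwa [hT, hTT, map_smul, hTT] at this
  have keysup {x : A} {μ ν : F} (hx : T x ∈ eig F a μ ⊔ eig F a ν) :
      x ∈ eig F (T a) μ ⊔ eig F (T a) ν := by
    obtain ⟨p, hp, q, hq, hpq⟩ := Submodule.mem_sup.1 hx
    have : x = T p + T q := by rw [← map_add, hpq, hTT]
    rw [this]
    exact Submodule.add_mem_sup (key.2 (by rwa [hTT])) (key.2 (by rwa [hTT]))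
  refine ⟨⟨?_, ?_, ?_, ?_, ?_, ?_, ?_, ?_, ?_⟩, ?_⟩
  · intro h0
    apply h.ne_zero
    rw [← hTT a, h0, map_zero]
  · rw [← hT, h.idem]
  · rw [eq_top_iff]
    intro x _
    obtain ⟨p, q, r, hx, hp, hq, hr⟩ := h.exists_parity (T x)
    have : x = T p + T q + T r := by rw [← map_add, ← map_add, ← hx, hTT]
    rw [this]
    exact Submodule.add_mem_sup (Submodule.add_mem_sup (key.2 (by rwa [hTT]))
      (key.2 (by rwa [hTT]))) (key.2 (by rwa [hTT]))
  · intro x hx y hy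
    rw [key, hT]; exact h.one_one _ (key.1 hx) _ (key.1 hy)
  · intro x hx y hy
    have := h.one_zero _ (key.1 hx) _ (key.1 hy)
    rw [← hTT (x * y), hT, this, map_zero]
  · intro x hx y hy
    rw [key, hT]; exact h.zero_zero _ (key.1 hx) _ (key.1 hy)
  · intro x hx y hy
    rw [key, hT]; exact h.one_half _ (key.1 hx) _ (key.1 hy)
  · intro x hx y hy
    rw [key, hT]; exact h.zero_half _ (key.1 hx) _ (key.1 hy)
  · intro x hx y hy
    apply keysup
    rw [hT]; exact h.half_half _ (key.1 hx) _ (key.1 hy)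
  · ext x
    rw [key, h.primitive, Submodule.mem_span_singleton, Submodule.mem_span_singleton]
    constructor
    · rintro ⟨k, hk⟩
      exact ⟨k, by rw [← map_smul, hk, hTT]⟩
    · rintro ⟨k, rfl⟩
      exact ⟨k, by rw [map_smul, hTT]⟩

lemma IsPrimitiveAxis.miyamoto (h2 : (2 : F) ≠ 0) {a c : A} (h : IsPrimitiveAxis F a)
    (hc : IsAxis F c) : IsPrimitiveAxis F (miyamoto F c a) :=
  h.map (hc.miyamoto_mul h2) (hc.miyamoto_miyamoto h2)

/-- Since `2λ² - λ` is `1` at `1` and vanishes at `0` and `1/2`, the operator `2L_a² - L_a` is the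
projection onto the line `Fa`; a functional with value `1` at `a` reads off the coefficient. -/
lemma IsPrimitiveAxis.exists_coord (h2 : (2 : F) ≠ 0) {a : A} (h : IsPrimitiveAxis F a) :
    ∃ φ : A →ₗ[F] F, ∀ x, (2 : F) • (a * (a * x)) = a * x + φ x • a := by
  obtain ⟨f, hf⟩ := Module.Projective.exists_dual_eq_one F h.ne_zero
  refine ⟨f ∘ₗ ((2 : F) • (LinearMap.mulLeft F a ∘ₗ LinearMap.mulLeft F a)
    - LinearMap.mulLeft F a), fun x => ?_⟩
  obtain ⟨p, q, r, rfl, hp, hq, hr⟩ := h.exists_decomp x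
  have hp' : p ∈ eig F a 1 := mem_eig.2 (by simpa using hp)
  rw [h.primitive, Submodule.mem_span_singleton] at hp'
  obtain ⟨k, rfl⟩ := hp'
  have e : (2 : F) • (a * (a * (k • a + q + r))) - a * (k • a + q + r) = k • a := by
    simp only [mul_add, mul_smul_comm, h.idem, hq, hr, mul_zero]
    match_scalars <;> field_simp <;> ring
  have e' : (f ∘ₗ ((2 : F) • (LinearMap.mulLeft F a ∘ₗ LinearMap.mulLeft F a)
    - LinearMap.mulLeft F a)) (k • a + q + r) = k := by
    have := congrArg f e
    rw [map_smul, hf] at this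
    simpa using this
  rw [e']; exact sub_eq_iff_eq_add'.1 e

end Axes

/-! ### Symmetry of the projection functionals and the Frobenius form. -/

section Form

variable {F A : Type*} [Field F] [NonUnitalNonAssocCommRing A] [Module F A]
  [SMulCommClass F A A] [IsScalarTower F A A]

open Classical in
variable (F) in
/-- The projection functional of a primitive axis. -/
noncomputable def coord (a : A) : A →ₗ[F] F :=
  if h : ∃ φ : A →ₗ[F] F, ∀ x, (2 : F) • (a * (a * x)) = a * x + φ x • a then h.choose else 0

lemma IsPrimitiveAxis.coord_spec (h2 : (2 : F) ≠ 0) {a : A} (h : IsPrimitiveAxis F a) (x : A) :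
    (2 : F) • (a * (a * x)) = a * x + coord F a x • a := by
  have hex := h.exists_coord h2
  rw [coord, dif_pos hex]
  exact hex.choose_spec x

lemma smul_ne_zero_inj {a : A} (ha : a ≠ 0) {k l : F} (h : k • a = l • a) : k = l := by
  by_contra hkl
  have : (k - l) • a = 0 := by rw [sub_smul, h, sub_self]
  exact (smul_ne_zero (sub_ne_zero.2 hkl) ha) this

lemma half_add_half (h2 : (2 : F) ≠ 0) (x : A) : (2 : F) • (2⁻¹ : F) • x = x := by
  rw [smul_smul, mul_inv_cancel₀ h2, one_smul]

lemma smul_two_cancel {W : Type*} [AddCommGroup W] [Module F W] (h2 : (2 : F) ≠ 0) {x y : W} (h : (2 : F) • x = (2 : F) • y) : x = y := by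
  have := congrArg (fun w => (2⁻¹ : F) • w) h
  simpa only [inv_smul_smul₀ h2] using this

lemma IsPrimitiveAxis.coord_self (h2 : (2 : F) ≠ 0) {a : A} (h : IsPrimitiveAxis F a) :
    coord F a a = 1 := by
  have := h.coord_spec h2 a
  rw [h.idem, h.idem, two_smul] at this
  exact smul_ne_zero_inj h.ne_zero (by rw [one_smul]; exact (add_left_cancel this).symm)

lemma IsPrimitiveAxis.coord_zero (h2 : (2 : F) ≠ 0) {a x : A} (h : IsPrimitiveAxis F a)
    (hx : a * x = 0) : coord F a x = 0 := by
  have := h.coord_spec h2 x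
  rw [hx, mul_zero, smul_zero, zero_add] at this
  exact smul_ne_zero_inj h.ne_zero (by rw [zero_smul]; exact this.symm)

lemma IsPrimitiveAxis.coord_half (h2 : (2 : F) ≠ 0) {a x : A} (h : IsPrimitiveAxis F a)
    (hx : a * x = (2⁻¹ : F) • x) : coord F a x = 0 := by
  have := h.coord_spec h2 x
  rw [hx, mul_smul_comm, hx, half_add_half h2] at this
  exact smul_ne_zero_inj h.ne_zero (by rw [zero_smul]; exact (left_eq_add.1 this))

/-- Peirce decomposition with respect to a primitive axis. -/
lemma IsPrimitiveAxis.exists_peirce (h2 : (2 : F) ≠ 0) {a : A} (h : IsPrimitiveAxis F a) (x : A) :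
    ∃ z y : A, x = coord F a x • a + z + y ∧ a * z = 0 ∧ a * y = (2⁻¹ : F) • y := by
  obtain ⟨p, q, r, rfl, hp, hq, hr⟩ := h.exists_parity x
  rw [h.primitive, Submodule.mem_span_singleton] at hp
  obtain ⟨k, rfl⟩ := hp
  rw [mem_eig] at hq hr
  rw [zero_smul] at hq
  refine ⟨q, r, ?_, hq, hr⟩
  rw [map_add, map_add, map_smul, h.coord_self h2, h.coord_zero h2 hq, h.coord_half h2 hr]
  simp

lemma IsPrimitiveAxis.miyamoto_eq (h2 : (2 : F) ≠ 0) {a : A} (h : IsPrimitiveAxis F a) (x : A) :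
    JordanHalf.miyamoto F a x = x - (4 : F) • (a * x) + (4 * coord F a x) • a := by
  have e : (8 : F) • (a * (a * x)) = (4 : F) • (2 : F) • (a * (a * x)) := by module
  rw [miyamoto_apply, e, h.coord_spec h2]
  module

/-- The degenerate case of `coord_comm`. Only `k = 0` and `k = 1` survive: `k = 1/2` would make `a =
a²` both odd and even for `b`, and any other `k` makes `b` a multiple of `a`, so `b = a` and `k = 1`
after all. -/
lemma IsPrimitiveAxis.coord_comm_of_mul_eq_smul (h2 : (2 : F) ≠ 0) {a b : A} (ha : IsPrimitiveAxis F a)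
    (hb : IsPrimitiveAxis F b) (k : F) (hab : a * b = k • a) : coord F a b = coord F b a := by
  obtain ⟨z, y, hx, hz, hy⟩ := hb.exists_peirce h2 a
  have hba : b * a = k • a := by rw [mul_comm, hab]
  by_cases h0 : k = 0
  · rw [h0, zero_smul] at hab hba
    rw [ha.coord_zero h2 hab, hb.coord_zero h2 hba]
  by_cases h1 : k = 1
  · rw [h1, one_smul] at hab hba
    have : a ∈ eig F b 1 := mem_eig.2 (by simpa using hba)
    rw [hb.primitive, Submodule.mem_span_singleton] at this
    obtain ⟨l, rfl⟩ := this
    have hl := ha.idem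
    have hne := ha.ne_zero
    rw [smul_mul_smul_comm, hb.idem] at hl
    have hll := smul_ne_zero_inj hb.ne_zero hl
    have : l ≠ 0 := by rintro rfl; simp at hne
    have : l = 1 := by simpa [this] using hll
    simp [this]
  · have h3 : coord F b a • b + (2⁻¹ : F) • y = k • a := by
      rw [← hba]
      conv_rhs => rw [hx]
      rw [mul_add, mul_add, mul_smul_comm, hb.idem, hz, hy, add_zero]
    have hs := hb.coord_spec h2 a
    rw [hba, mul_smul_comm, hba] at hs
    have hs' : (2 * k * k - k) • a = coord F b a • b := by
      rw [← add_sub_cancel_left (k • a) (coord F b a • b), ← hs]; module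
    by_cases hc : coord F b a = 0
    · rw [hc, zero_smul, smul_eq_zero] at hs'
      have hk := hs'.resolve_right ha.ne_zero
      have hk : k = 2⁻¹ := by
        apply eq_inv_of_mul_eq_one_left
        apply mul_left_cancel₀ h0
        linear_combination hk
      subst hk
      have hm : a ∈ eig F b 2⁻¹ := mem_eig.2 hba
      have := miyamoto_of_mem_sup (hb.half_half a hm a hm)
      rw [ha.idem, miyamoto_of_half h2 hba] at this
      exfalso
      apply ha.ne_zero
      have : (2 : F) • a = 0 := by
        rw [two_smul]; nth_rewrite 1 [← this]; exact neg_add_cancel a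
      exact (smul_eq_zero.1 this).resolve_left h2
    · exfalso
      have hb' : b = ((coord F b a)⁻¹ * (2 * k * k - k)) • a := by
        rw [mul_smul, hs', smul_smul, inv_mul_cancel₀ hc, one_smul]
      set l := (coord F b a)⁻¹ * (2 * k * k - k)
      have hl := hb.idem
      have hne := hb.ne_zero
      rw [hb', smul_mul_smul_comm, ha.idem] at hl
      have hll := smul_ne_zero_inj ha.ne_zero hl
      have : l ≠ 0 := by intro h; rw [h, zero_smul] at hb'; exact hne hb'
      have : l = 1 := by simpa [this] using hll
      rw [hb', this, one_smul, ha.idem] at hab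
      exact h1 (smul_ne_zero_inj ha.ne_zero (by rw [one_smul]; exact hab.symm))

/-- The odd and even parts with respect to an axis can be compared separately. -/
lemma IsAxis.odd_even_ext (h2 : (2 : F) ≠ 0) {a p q r s : A} (hp : miyamoto F a p = p)
    (hq : miyamoto F a q = q) (hr : miyamoto F a r = -r) (hs : miyamoto F a s = -s)
    (h : p + r = q + s) : p = q ∧ r = s := by
  have h' := congrArg (miyamoto F a) h
  rw [map_add, map_add, hp, hq, hr, hs] at h'
  have hpq : p = q := by
    apply smul_two_cancel h2
    have : (2 : F) • p = (p + r) + (p + -r) := by module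
    rw [this, h, h']; module
  subst hpq
  exact ⟨rfl, add_left_cancel h⟩

lemma IsPrimitiveAxis.odd_even_idem (h2 : (2 : F) ≠ 0) {a z u : A} {α : F}
    (ha : IsPrimitiveAxis F a) (hz : a * z = 0) (hu : a * u = (2⁻¹ : F) • u)
    (hb : (α • a + z + u) * (α • a + z + u) = α • a + z + u) :
    (α * α) • a + z * z + u * u = α • a + z ∧ (2 : F) • (z * u) = (1 - α) • u := by
  have mz : z ∈ eig F a 0 := mem_eig.2 (by simpa using hz)
  have mu : u ∈ eig F a 2⁻¹ := mem_eig.2 hu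
  have ma : JordanHalf.miyamoto F a a = a :=
    miyamoto_of_mem_sup (Submodule.mem_sup_left (mem_eig.2 (by simpa using ha.idem)))
  have mz' : JordanHalf.miyamoto F a z = z := miyamoto_of_mem_sup (Submodule.mem_sup_right mz)
  have mu' : JordanHalf.miyamoto F a u = -u := miyamoto_of_half h2 hu
  have mul := ha.miyamoto_mul h2
  have e : ((α * α) • a + z * z + u * u) + (α • u + (2 : F) • (z * u)) = (α • a + z) + u := by
    rw [← hb]
    simp only [add_mul, mul_add, smul_mul_assoc, mul_smul_comm, ha.idem, hz, hu, mul_comm z a,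
      mul_comm u a, mul_comm u z]
    match_scalars <;> field_simp <;> ring
  obtain ⟨e1, e2⟩ := IsAxis.odd_even_ext (a := a) h2
    (by simp only [map_add, map_smul, mul, ma, mz', mu']; simp)
    (by simp only [map_add, map_smul, ma, mz'])
    (by simp only [map_add, map_smul, mul, mz', mu', mul_neg, smul_neg, neg_add]) mu' e
  exact ⟨e1, by rw [sub_smul, one_smul]; exact eq_sub_of_add_eq' e2⟩

/-- The element `a + b - 2ab` has no `1/2`-component over either axis: it equals `(1-α)a + z` and
`(1-β)b + z'`. The second form shows that its product with `b` is `(1-β)b`; multiplying the first by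
`b` and comparing odd parts over `a` gives `(1-α)u = (1-β)u`. -/
lemma IsPrimitiveAxis.coord_comm (h2 : (2 : F) ≠ 0) {a b : A} (ha : IsPrimitiveAxis F a)
    (hb : IsPrimitiveAxis F b) : coord F a b = coord F b a := by
  obtain ⟨z, u, hx, hz, hu⟩ := ha.exists_peirce h2 b
  obtain ⟨z', u', hx', hz', hu'⟩ := hb.exists_peirce h2 a
  by_cases hu0 : u = 0
  · apply ha.coord_comm_of_mul_eq_smul h2 hb (coord F a b)
    conv_lhs => rw [hx, hu0]
    rw [add_zero, mul_add, hz, mul_smul_comm, ha.idem, add_zero]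
  set α := coord F a b
  set β := coord F b a
  have hab : a * b = α • a + (2⁻¹ : F) • u := by
    conv_lhs => rw [hx]
    simp only [mul_add, mul_smul_comm, ha.idem, hz, hu, add_zero]
  have hba : a * b = β • b + (2⁻¹ : F) • u' := by
    rw [mul_comm a b]
    conv_lhs => rw [hx']
    simp only [mul_add, mul_smul_comm, hb.idem, hz', hu', add_zero]
  have s1 : a + b - (2 : F) • (a * b) = (1 - α) • a + z := by
    rw [hab]; nth_rewrite 1 [hx]
    match_scalars <;> field_simp <;> ring
  have s2 : a + b - (2 : F) • (a * b) = (1 - β) • b + z' := by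
    rw [hba]; nth_rewrite 1 [hx']
    match_scalars <;> field_simp <;> ring
  have hbs : b * ((1 - α) • a + z) = (1 - β) • b := by
    rw [← s1, s2, mul_add, hz', mul_smul_comm, hb.idem, add_zero]
  obtain ⟨-, e2⟩ := ha.odd_even_idem (α := α) h2 hz hu (by rw [← hx, hb.idem])
  have mz : z ∈ eig F a 0 := mem_eig.2 (by simpa using hz)
  have mu : u ∈ eig F a 2⁻¹ := mem_eig.2 hu
  have ma : JordanHalf.miyamoto F a a = a :=
    miyamoto_of_mem_sup (Submodule.mem_sup_left (mem_eig.2 (by simpa using ha.idem)))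
  have mz' : JordanHalf.miyamoto F a z = z := miyamoto_of_mem_sup (Submodule.mem_sup_right mz)
  have mu' : JordanHalf.miyamoto F a u = -u := miyamoto_of_half h2 hu
  have mul := ha.miyamoto_mul h2
  have e : ((α * (1 - α)) • a + z * z) + (1 - α) • u = (1 - β) • (α • a + z) + (1 - β) • u := by
    have zu : z * u = ((1 - α) * 2⁻¹) • u := by
      apply smul_two_cancel h2
      rw [e2, smul_smul]
      congr 1
      field_simp
    rw [hx] at hbs
    calc _ = (α • a + z + u) * ((1 - α) • a + z) := by
          simp only [add_mul, mul_add, smul_mul_assoc, mul_smul_comm, ha.idem, hz, hu,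
            mul_comm z a, mul_comm u a, mul_comm u z, zu]
          match_scalars <;> field_simp <;> ring
      _ = _ := by rw [hbs]; module
  obtain ⟨-, e3⟩ := IsAxis.odd_even_ext (a := a) h2
    (by simp only [map_add, map_smul, mul, ma, mz'])
    (by simp only [map_add, map_smul, ma, mz'])
    (by simp only [map_smul, mu', smul_neg]) (by simp only [map_smul, mu', smul_neg]) e
  have := smul_ne_zero_inj hu0 e3
  linear_combination -this

/-- Peirce components of one primitive axis with respect to another. -/
lemma IsPrimitiveAxis.exists_line (h2 : (2 : F) ≠ 0) {a b : A} (ha : IsPrimitiveAxis F a)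
    (hb : IsPrimitiveAxis F b) : ∃ z u : A, b = coord F a b • a + z + u ∧ a * z = 0 ∧
      a * u = (2⁻¹ : F) • u ∧ z * z = (1 - coord F a b) • z ∧
      z * u = ((1 - coord F a b) * 2⁻¹) • u ∧
      u * u = (coord F a b * (1 - coord F a b)) • a + coord F a b • z := by
  obtain ⟨z, u, hx, hz, hu⟩ := ha.exists_peirce h2 b
  obtain ⟨z', u', hx', hz', hu'⟩ := hb.exists_peirce h2 a
  rw [← ha.coord_comm h2 hb] at hx'
  set α := coord F a b
  obtain ⟨e1, e2⟩ := ha.odd_even_idem (α := α) h2 hz hu (by rw [← hx, hb.idem])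
  have zu : z * u = ((1 - α) * 2⁻¹) • u := by
    apply smul_two_cancel h2
    rw [e2, smul_smul]
    congr 1
    field_simp
  have hab : a * b = α • a + (2⁻¹ : F) • u := by
    conv_lhs => rw [hx]
    simp only [mul_add, mul_smul_comm, ha.idem, hz, hu, add_zero]
  have hba : a * b = α • b + (2⁻¹ : F) • u' := by
    rw [mul_comm a b]
    conv_lhs => rw [hx']
    simp only [mul_add, mul_smul_comm, hb.idem, hz', hu', add_zero]
  have s1 : a + b - (2 : F) • (a * b) = (1 - α) • a + z := by
    rw [hab]; nth_rewrite 1 [hx]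
    match_scalars <;> field_simp <;> ring
  have s2 : a + b - (2 : F) • (a * b) = (1 - α) • b + z' := by
    rw [hba]; nth_rewrite 1 [hx']
    match_scalars <;> field_simp <;> ring
  have hbs : b * ((1 - α) • a + z) = (1 - α) • b := by
    rw [← s1, s2, mul_add, hz', mul_smul_comm, hb.idem, add_zero]
  -- The odd part of `hbs` is the symmetry of `coord`; its even part determines `z * z`.
  have zz : z * z = (1 - α) • z := by
    rw [hx] at hbs
    have : (α • a + z + u) * ((1 - α) • a + z)
        = (α * (1 - α)) • a + z * z + (1 - α) • u := by
      simp only [add_mul, mul_add, smul_mul_assoc, mul_smul_comm, ha.idem, hz, hu,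
        mul_comm z a, mul_comm u a, mul_comm u z, zu]
      match_scalars <;> field_simp <;> ring
    rw [this] at hbs
    calc z * z = ((α * (1 - α)) • a + z * z + (1 - α) • u)
          - ((α * (1 - α)) • a + (1 - α) • u) := by abel
      _ = _ := by rw [hbs]; module
  refine ⟨z, u, hx, hz, hu, zz, zu, ?_⟩
  calc u * u = ((α * α) • a + z * z + u * u) - ((α * α) • a + z * z) := by abel
    _ = _ := by rw [e1, zz]; module

/-- An axial algebra is spanned by its primitive axes. -/
lemma IsPrimitiveAxialAlgebra.span_axes (h2 : (2 : F) ≠ 0) {X : Set A}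
    (hX : IsPrimitiveAxialAlgebra F X) : Submodule.span F {c : A | IsPrimitiveAxis F c} = ⊤ := by
  set S := Submodule.span F {c : A | IsPrimitiveAxis F c}
  have h4 : (4 : F) ≠ 0 := by
    have : (4 : F) = 2 * 2 := by norm_num
    rw [this]; exact mul_ne_zero h2 h2
  have hmul : ∀ x ∈ S, ∀ y ∈ S, x * y ∈ S := by
    intro x hx y hy
    induction hx using Submodule.span_induction with
    | mem a ha =>
      induction hy using Submodule.span_induction with
      | mem b hb =>
        -- The formula for `τ_a b` solved for the product: `ab` is a combination of the primitive
        -- axes `a`, `b` and `τ_a b`.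
        have hab : a * b = (4⁻¹ : F) • (b + (4 * coord F a b) • a - miyamoto F a b) := by
          rw [IsPrimitiveAxis.miyamoto_eq h2 ha]
          match_scalars <;> field_simp <;> ring
        rw [hab]
        refine S.smul_mem _ (S.sub_mem (S.add_mem (Submodule.subset_span hb)
          (S.smul_mem _ (Submodule.subset_span ha))) (Submodule.subset_span ?_))
        exact IsPrimitiveAxis.miyamoto h2 hb ha.toIsAxis
      | zero => rw [mul_zero]; exact S.zero_mem
      | add y z _ _ h h' => rw [mul_add]; exact S.add_mem h h'
      | smul k y _ h => rw [mul_smul_comm]; exact S.smul_mem _ h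
    | zero => rw [zero_mul]; exact S.zero_mem
    | add y z _ _ h h' => rw [add_mul]; exact S.add_mem h h'
    | smul k y _ h => rw [smul_mul_assoc]; exact S.smul_mem _ h
  rw [eq_top_iff]
  rintro x -
  have hx : x ∈ NonUnitalAlgebra.adjoin F X := by rw [hX.generates]; trivial
  induction hx using NonUnitalAlgebra.adjoin_induction with
  | mem x hx => exact Submodule.subset_span (hX.axis x hx)
  | add x y _ _ h h' => exact S.add_mem h h'
  | zero => exact S.zero_mem
  | mul x y _ _ h h' => exact hmul x h y h'
  | smul k x _ h => exact S.smul_mem _ h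

/-- A symmetric associating bilinear form that restricts to the projection functional of every
primitive axis. -/
structure IsFrobeniusForm (B : A →ₗ[F] A →ₗ[F] F) : Prop where
  symm : ∀ x y, B x y = B y x
  assoc : ∀ x y z, B (x * y) z = B x (y * z)
  axis : ∀ c, IsPrimitiveAxis F c → ∀ x, B c x = coord F c x

lemma IsPrimitiveAxis.coord_miyamoto (h2 : (2 : F) ≠ 0) {a c : A} (ha : IsPrimitiveAxis F a)
    (hc : IsAxis F c) (x : A) :
    coord F (JordanHalf.miyamoto F c a) (JordanHalf.miyamoto F c x) = coord F a x := by
  have h := (ha.miyamoto h2 hc).coord_spec h2 (JordanHalf.miyamoto F c x)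
  have hm := hc.miyamoto_mul h2
  have h' := congrArg (JordanHalf.miyamoto F c) (ha.coord_spec h2 x)
  rw [map_smul, map_add, map_smul, hm, hm] at h'
  rw [h'] at h
  exact (smul_ne_zero_inj (ha.miyamoto h2 hc).ne_zero (add_left_cancel h)).symm

/-- Take a basis of primitive axes and let each pair with `x` through its own `coord`; symmetry of
`coord` extends this to every primitive axis. Invariance under `τ_c` makes the `0`- and
`1/2`-eigenspaces of `c` orthogonal, so multiplication by `c` is self-adjoint, and axes span. -/
lemma IsPrimitiveAxialAlgebra.exists_frobeniusForm (h2 : (2 : F) ≠ 0) {X : Set A}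
    (hX : IsPrimitiveAxialAlgebra F X) : ∃ B : A →ₗ[F] A →ₗ[F] F, IsFrobeniusForm B := by
  have hspan := hX.span_axes h2
  set Y := {c : A | IsPrimitiveAxis F c} with hY
  obtain ⟨s, hsY, hs, hli⟩ := exists_linearIndependent F Y
  let e : Module.Basis s F A := Module.Basis.mk hli (by
    rw [Subtype.range_coe, hs, hspan])
  let B : A →ₗ[F] A →ₗ[F] F := e.constr F fun i => coord F (i : A)
  have he (i : s) : e i = (i : A) := by simp [e]
  have ext {f g : A →ₗ[F] F} (h : ∀ c ∈ Y, f c = g c) : f = g :=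
    LinearMap.ext_on hspan h
  have hB0 (i : s) (x : A) : B (i : A) x = coord F (i : A) x := by
    rw [← he i]; simp only [B, e.constr_basis]; rw [he]
  have hB (c : A) (hc : IsPrimitiveAxis F c) : B c = coord F c := by
    apply ext
    intro d hd
    have : B.flip d = coord F d := by
      apply e.ext
      intro i
      rw [LinearMap.flip_apply, he, hB0]
      exact IsPrimitiveAxis.coord_comm h2 (hsY i.2) hd
    rw [← LinearMap.flip_apply, this]
    exact IsPrimitiveAxis.coord_comm h2 hd hc
  have hsymm : B = B.flip := by
    apply LinearMap.ext_on hspan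
    intro c hc
    apply ext
    intro d hd
    rw [LinearMap.flip_apply, hB c hc, hB d hd]
    exact IsPrimitiveAxis.coord_comm h2 hc hd
  have symm (x y : A) : B x y = B y x := by
    conv_lhs => rw [hsymm]
    rfl
  have hT (c : A) (hc : IsPrimitiveAxis F c) (x y : A) :
      B (miyamoto F c x) (miyamoto F c y) = B x y := by
    have : (B.compl₁₂ (miyamoto F c) (miyamoto F c)) = B := by
      apply LinearMap.ext_on hspan
      intro d hd
      ext y
      rw [LinearMap.compl₁₂_apply, hB d hd, hB _ (IsPrimitiveAxis.miyamoto h2 hd hc.toIsAxis)]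
      exact IsPrimitiveAxis.coord_miyamoto h2 hd hc.toIsAxis y
    conv_rhs => rw [← this]
    rfl
  have hax (c : A) (hc : IsPrimitiveAxis F c) (x z : A) : B (c * x) z = B x (c * z) := by
    obtain ⟨p, q, hx, hp, hq⟩ := hc.exists_peirce h2 x
    obtain ⟨p', q', hz, hp', hq'⟩ := hc.exists_peirce h2 z
    have o1 : B c p = 0 := by rw [hB c hc, hc.coord_zero h2 hp]
    have o2 : B c p' = 0 := by rw [hB c hc, hc.coord_zero h2 hp']
    have o3 : B c q = 0 := by rw [hB c hc, hc.coord_half h2 hq]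
    have o4 : B c q' = 0 := by rw [hB c hc, hc.coord_half h2 hq']
    have mp (p : A) (hp : c * p = 0) : miyamoto F c p = p :=
      miyamoto_of_mem_sup (Submodule.mem_sup_right (mem_eig.2 (by simpa using hp)))
    have o (p q : A) (hp : c * p = 0) (hq : c * q = (2⁻¹ : F) • q) : B p q = 0 := by
      have := hT c hc p q
      rw [mp p hp, miyamoto_of_half h2 hq, map_neg] at this
      have : (2 : F) * B p q = 0 := by linear_combination -this
      exact (mul_eq_zero.1 this).resolve_left h2
    have o5 := o p q' hp hq'
    have o6 := o p' q hp' hq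
    rw [hx, hz]
    simp only [mul_add, mul_smul_comm, hc.idem, hp, hq, hp', hq', map_add, map_smul,
      LinearMap.add_apply, LinearMap.smul_apply, smul_eq_mul, add_zero, o2, o4, o5, symm q c, o3,
      symm p c, o1, symm q p', o6]
    ring
  refine ⟨B, symm, fun x y z => ?_, fun c hc x => by rw [hB c hc]⟩
  have hy : y ∈ Submodule.span F Y := by rw [hspan]; trivial
  induction hy using Submodule.span_induction with
  | mem c hc => rw [mul_comm, hax c hc]
  | zero => simp
  | add y z _ _ h h' => simp only [mul_add, add_mul, map_add, LinearMap.add_apply, h, h']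
  | smul k y _ h =>
    simp only [mul_smul_comm, smul_mul_assoc, map_smul, LinearMap.smul_apply, h]

end Form

/-! ### Quadratic identities characterising axes. -/

section Identities

variable {F A : Type*} [Field F] [NonUnitalNonAssocCommRing A] [Module F A]
  [SMulCommClass F A A] [IsScalarTower F A A]

/-- Value of a quadratic-plus-linear map. -/
def quadEval {W : Type*} [AddCommGroup W] [Module F W] (G : A →ₗ[F] A →ₗ[F] W) (l : A →ₗ[F] W)
    (c : A) : W := G c c + l c

/-- Derivative at `c` in the direction `d` of a quadratic-plus-linear map. -/
def quadDeriv {W : Type*} [AddCommGroup W] [Module F W] (G : A →ₗ[F] A →ₗ[F] W) (l : A →ₗ[F] W)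
    (c d : A) : W := G c d + G d c + l d

/-- Quadratic part of the identity `2 c (c x) = c x + (c, x) c`. -/
def sqQuad (B : A →ₗ[F] A →ₗ[F] F) (x : A) : A →ₗ[F] A →ₗ[F] A :=
  LinearMap.mk₂ F (fun c d => (2 : F) • (c * (d * x)) - B c x • d)
    (by intros; simp only [add_mul, map_add, LinearMap.add_apply]; module)
    (by intros; simp only [smul_mul_assoc, map_smul, LinearMap.smul_apply, smul_eq_mul]; module)
    (by intros; simp only [add_mul, mul_add]; module)
    (by intros; simp only [smul_mul_assoc, mul_smul_comm]; module)

/-- Linear part of the identity `2 c (c x) = c x + (c, x) c`. -/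
def sqLin (x : A) : A →ₗ[F] A := -LinearMap.mulRight F x

/-- Quadratic part of the identity expressing that the Miyamoto map of `c` is multiplicative. -/
def mulQuad (B : A →ₗ[F] A →ₗ[F] F) (x y : A) : A →ₗ[F] A →ₗ[F] A :=
  LinearMap.mk₂ F (fun c d => (4 : F) • ((c * x) * (d * y)) - B c (x * y) • d - B c x • (d * y)
      - B c y • (d * x))
    (by intros; simp only [add_mul, map_add, LinearMap.add_apply]; module)
    (by intros; simp only [smul_mul_assoc, map_smul, LinearMap.smul_apply, smul_eq_mul]; module)
    (by intros; simp only [add_mul, mul_add]; module)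
    (by intros; simp only [smul_mul_assoc, mul_smul_comm]; module)

/-- Linear part of the identity expressing that the Miyamoto map of `c` is multiplicative. -/
def mulLin (x y : A) : A →ₗ[F] A :=
  LinearMap.mulRight F (x * y) - LinearMap.mulRight F y ∘ₗ LinearMap.mulRight F x
    - LinearMap.mulLeft F x ∘ₗ LinearMap.mulRight F y

lemma sqEval_eq (B : A →ₗ[F] A →ₗ[F] F) (x c : A) :
    quadEval (sqQuad B x) (sqLin x) c = (2 : F) • (c * (c * x)) - B c x • c - c * x := by
  simp [quadEval, sqQuad, sqLin, sub_eq_add_neg]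

lemma mulEval_eq (B : A →ₗ[F] A →ₗ[F] F) (x y c : A) :
    quadEval (mulQuad B x y) (mulLin x y) c = (4 : F) • ((c * x) * (c * y)) - B c (x * y) • c
      - B c x • (c * y) - B c y • (c * x) + (c * (x * y) - (c * x) * y - x * (c * y)) := by
  simp [quadEval, mulQuad, mulLin]

lemma sqDeriv_eq (B : A →ₗ[F] A →ₗ[F] F) (x c d : A) :
    quadDeriv (sqQuad B x) (sqLin x) c d = ((2 : F) • (c * (d * x)) - B c x • d)
      + ((2 : F) • (d * (c * x)) - B d x • c) - d * x := by
  simp [quadDeriv, sqQuad, sqLin, sub_eq_add_neg]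

lemma mulDeriv_eq (B : A →ₗ[F] A →ₗ[F] F) (x y c d : A) :
    quadDeriv (mulQuad B x y) (mulLin x y) c d =
      ((4 : F) • ((c * x) * (d * y)) - B c (x * y) • d - B c x • (d * y) - B c y • (d * x))
      + ((4 : F) • ((d * x) * (c * y)) - B d (x * y) • c - B d x • (c * y) - B d y • (c * x))
      + (d * (x * y) - (d * x) * y - x * (d * y)) := by
  simp [quadDeriv, mulQuad, mulLin]

/-- Both defining identities of a primitive axis vanish at `c`. -/
def AxisIdentities (B : A →ₗ[F] A →ₗ[F] F) (c : A) : Prop :=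
  (∀ x, quadEval (sqQuad B x) (sqLin x) c = 0) ∧
    ∀ x y, quadEval (mulQuad B x y) (mulLin x y) c = 0

lemma four_ne_zero_of_two (h2 : (2 : F) ≠ 0) : (4 : F) ≠ 0 := by
  have : (4 : F) = 2 * 2 := by norm_num
  rw [this]; exact mul_ne_zero h2 h2

lemma IsFrobeniusForm.sq {B : A →ₗ[F] A →ₗ[F] F} (hB : IsFrobeniusForm B) (h2 : (2 : F) ≠ 0)
    {c : A} (hc : IsPrimitiveAxis F c) (x : A) :
    c * (c * x) = (2⁻¹ : F) • (c * x) + (2⁻¹ * B c x) • c := by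
  apply smul_two_cancel h2
  rw [hc.coord_spec h2, hB.axis c hc]
  match_scalars <;> field_simp

lemma IsFrobeniusForm.miyamoto_eq {B : A →ₗ[F] A →ₗ[F] F} (hB : IsFrobeniusForm B)
    (h2 : (2 : F) ≠ 0) {c : A} (hc : IsPrimitiveAxis F c) (x : A) :
    miyamoto F c x = x - (4 : F) • (c * x) + (4 * B c x) • c := by
  rw [hc.miyamoto_eq h2, hB.axis c hc]

/-- Expanding `τ_c(xy) = τ_c(x)τ_c(y)` produces terms of degree above two in `c`, but the first
identity reduces or cancels them, and a factor `-4` splits off. -/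
lemma IsFrobeniusForm.axisIdentities {B : A →ₗ[F] A →ₗ[F] F} (hB : IsFrobeniusForm B)
    (h2 : (2 : F) ≠ 0) {c : A} (hc : IsPrimitiveAxis F c) : AxisIdentities B c := by
  have h4 := four_ne_zero_of_two h2
  refine ⟨fun x => ?_, fun x y => ?_⟩
  · rw [sqEval_eq, hB.sq h2 hc]
    match_scalars <;> field_simp <;> ring
  · have h := hc.miyamoto_mul h2 x y
    simp only [hB.miyamoto_eq h2 hc] at h
    simp only [add_mul, mul_add, sub_mul, mul_sub, smul_mul_assoc, mul_smul_comm, hc.idem,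
      mul_comm _ c, hB.sq h2 hc] at h
    rw [mulEval_eq]
    have : (-(4 : F)) • ((4 : F) • ((c * x) * (c * y)) - B c (x * y) • c
      - B c x • (c * y) - B c y • (c * x) + (c * (x * y) - (c * x) * y - x * (c * y))) = 0 := by
      rw [← sub_eq_zero] at h
      rw [← h]
      match_scalars <;> field_simp <;> ring
    exact (smul_eq_zero.1 this).resolve_left (neg_ne_zero.2 h4)

/-- A nonzero idempotent satisfying the two identities is an axis. -/
lemma AxisIdentities.isAxis {B : A →ₗ[F] A →ₗ[F] F} (hB : IsFrobeniusForm B)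
    (h2 : (2 : F) ≠ 0) {c : A} (h : AxisIdentities B c) (h0 : c ≠ 0) (hcc : c * c = c) :
    IsAxis F c := by
  have hsq (x : A) : (2 : F) • (c * (c * x)) = c * x + B c x • c := by
    have := h.1 x
    rw [sqEval_eq] at this
    rw [sub_sub, sub_eq_zero] at this
    rw [this, add_comm]
  have hsq' (x : A) : c * (c * x) = (2⁻¹ : F) • (c * x) + (2⁻¹ * B c x) • c := by
    apply smul_two_cancel h2
    rw [hsq]
    match_scalars <;> field_simp
  have hm (x y : A) : c * (x * y) = B c (x * y) • c + (c * x) * y + x * (c * y)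
      - (4 : F) • ((c * x) * (c * y)) + B c x • (c * y) + B c y • (c * x) := by
    have := h.2 x y
    rw [mulEval_eq] at this
    rw [← sub_eq_zero, ← this]
    abel
  have hBcc : B c c = 1 := by
    have := hsq c
    rw [hcc, hcc, two_smul] at this
    exact smul_ne_zero_inj h0 (by rw [one_smul]; exact (add_left_cancel this).symm)
  have hone {x : A} (hx : c * x = x) : x = B c x • c := by
    have := hsq x
    rw [hx, hx, two_smul] at this
    exact add_left_cancel this
  have hBz {x : A} (hx : c * x = 0) : B c x = 0 := by
    have := hB.assoc c c x
    rwa [hcc, hx, map_zero] at this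
  have hBh {x : A} (hx : c * x = (2⁻¹ : F) • x) : B c x = 0 := by
    have := hB.assoc c c x
    rw [hcc, hx, map_smul, smul_eq_mul] at this
    field_simp at this
    linear_combination this
  have e1 {x : A} : x ∈ eig F c 1 ↔ c * x = x := by rw [mem_eig, one_smul]
  have e0 {x : A} : x ∈ eig F c 0 ↔ c * x = 0 := by rw [mem_eig, zero_smul]
  have hm0 {x y : A} (hx : c * x = 0) : B c (x * y) = 0 := by
    rw [← hB.assoc, hx]; simp
  have hc1 : c ∈ eig F c 1 := e1.2 hcc
  refine ⟨h0, hcc, ?_, ?_, ?_, ?_, ?_, ?_, ?_⟩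
  · rw [eq_top_iff]
    intro x _
    -- The Peirce projections `2L² - L`, `1 - 3L + 2L²` and `4L - 4L²`, with `L = L_c`, rewritten by
    -- means of `2L²x = Lx + (c,x)c`.
    have hx : x = B c x • c + (x - (2 : F) • (c * x) + B c x • c)
        + ((2 : F) • (c * x) - (2 * B c x) • c) := by module
    rw [hx]
    refine Submodule.add_mem_sup (Submodule.add_mem_sup (Submodule.smul_mem _ _ hc1) (e0.2 ?_))
      (mem_eig.2 ?_)
    · simp only [mul_add, mul_sub, mul_smul_comm, hsq, hcc]; module
    · simp only [mul_sub, mul_smul_comm, hsq', hcc]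
      match_scalars <;> field_simp
      ring
  · intro x hx y hy
    rw [e1] at *
    rw [hone hx, hone hy]
    simp only [mul_smul_comm, smul_mul_assoc, hcc]
  · intro x hx y hy
    rw [e1] at hx
    rw [e0] at hy
    rw [hone hx, smul_mul_assoc, hy, smul_zero]
  · intro x hx y hy
    rw [e0] at *
    rw [hm, hx, hy, hm0 hx, hBz hx, hBz hy]; simp
  · intro x hx y hy
    rw [e1] at hx
    rw [hone hx, smul_mul_assoc, mem_eig.1 hy]
    exact Submodule.smul_mem _ _ (Submodule.smul_mem _ _ hy)
  · intro x hx y hy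
    rw [e0] at hx
    rw [mem_eig] at *
    rw [hm, hx, hy, hm0 hx, hBz hx, hBh hy]; simp [mul_smul_comm]
  · intro x hx y hy
    rw [mem_eig] at hx hy
    have : x * y = B c (x * y) • c + (x * y - B c (x * y) • c) := by abel
    rw [this]
    refine Submodule.add_mem_sup (Submodule.smul_mem _ _ hc1) (e0.2 ?_)
    rw [mul_sub, mul_smul_comm, hcc, hm, hx, hy, hBh hx, hBh hy]
    simp only [mul_smul_comm, smul_mul_assoc]
    match_scalars <;> field_simp <;> ring

/-- A skew derivation propagates the vanishing of the identities to first order. -/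
lemma AxisIdentities.deriv_eq_zero {B : A →ₗ[F] A →ₗ[F] F} {c : A} (h : AxisIdentities B c)
    {d : A →ₗ[F] A} (hd : IsDerivation d) (hs : ∀ x y, B (d x) y = -B x (d y)) :
    (∀ x, quadDeriv (sqQuad B x) (sqLin x) c (d c) = 0) ∧
    ∀ x y, quadDeriv (mulQuad B x y) (mulLin x y) c (d c) = 0 := by
  have hd' : ∀ x y, d (x * y) = d x * y + x * d y := hd
  refine ⟨fun x => ?_, fun x y => ?_⟩
  · have h1 := congrArg d (h.1 x)
    have h2 := h.1 (d x)
    rw [sqEval_eq] at h1 h2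
    simp only [map_sub, map_smul, hd', map_zero] at h1
    rw [sqDeriv_eq, hs, ← sub_zero (0 : A)]
    nth_rewrite 1 [← h1]
    rw [← h2]
    simp only [mul_add]
    module
  · have h1 := congrArg d (h.2 x y)
    have h2 := h.2 (d x) y
    have h3 := h.2 x (d y)
    rw [mulEval_eq] at h1 h2 h3
    simp only [map_sub, map_add, map_smul, hd', map_zero] at h1
    rw [mulDeriv_eq, hs, hs, hs, hd', ← sub_zero (0 : A), ← sub_zero ((0 : A) - 0)]
    nth_rewrite 1 [← h1]
    nth_rewrite 1 [← h2]
    rw [← h3]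
    simp only [mul_add, add_mul, map_add]
    module

/-! ### Interpolation of quadratic polynomials on a conic. -/

section Interpolation

variable {W : Type*} [AddCommGroup W] [Module F W] {G : A →ₗ[F] A →ₗ[F] W} {l : A →ₗ[F] W}

/-- Two symmetric pairs of zeros on a conic force the tangential derivative to vanish. -/
lemma quadDeriv_eq_zero_of_zeros (h2 : (2 : F) ≠ 0) {a p u : A} {s t : F} (ht : t ≠ 0)
    (hs : s ≠ 1) (h1 : quadEval G l (a + p + u) = 0) (h1' : quadEval G l (a + p - u) = 0)
    (h3 : quadEval G l (a + s • p + t • u) = 0) (h3' : quadEval G l (a + s • p - t • u) = 0) :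
    quadDeriv G l a u = 0 := by
  -- The difference across a symmetric pair is `2t` times the derivative plus `2st` times the polar
  -- term of `p` and `u`; the pair at `(1,1)` eliminates the polar term.
  have e : (2 * t * (1 - s)) • quadDeriv G l a u
      = (quadEval G l (a + s • p + t • u) - quadEval G l (a + s • p - t • u))
        - (s * t) • (quadEval G l (a + p + u) - quadEval G l (a + p - u)) := by
    simp only [quadEval, quadDeriv, map_add, map_sub, map_smul, LinearMap.add_apply,
      LinearMap.sub_apply, LinearMap.smul_apply]
    module
  rw [h1, h1', h3, h3'] at e
  simp only [sub_self, smul_zero] at e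
  exact (smul_eq_zero.1 e).resolve_left
    (mul_ne_zero (mul_ne_zero h2 ht) (sub_ne_zero.2 (Ne.symm hs)))

/-- A symmetric pair of zeros whose midpoint direction is orthogonal to the chord forces the
tangential derivative to vanish. -/
lemma quadDeriv_eq_zero_of_polar (h2 : (2 : F) ≠ 0) {a p u : A} (hp : G p u + G u p = 0)
    (h1 : quadEval G l (a + p + u) = 0) (h1' : quadEval G l (a + p - u) = 0) :
    quadDeriv G l a u = 0 := by
  apply smul_two_cancel h2
  simp only [quadEval, quadDeriv, map_add, map_sub, LinearMap.add_apply,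
    LinearMap.sub_apply] at *
  linear_combination (norm := module) h1 - h1' - (2 : F) • hp

/-- Vanishing at `a`, `a + p ± u` together with tangential vanishing at `a` and `a + p + u` implies
vanishing on the whole conic `α t² = s - (1 - α) s²`. -/
lemma quadEval_eq_zero_on_conic (h2 : (2 : F) ≠ 0) {a p u : A} {α s t : F}
    (hst : α * t ^ 2 = s - (1 - α) * s ^ 2)
    (h0 : quadEval G l a = 0)
    (h1 : quadEval G l (a + p + u) = 0) (h1' : quadEval G l (a + p - u) = 0)
    (hd : quadDeriv G l a u = 0)
    (hd' : quadDeriv G l (a + p + u) ((-2 * α) • p + (1 - 2 * α) • u) = 0) :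
    quadEval G l (a + s • p + t • u) = 0 := by
  simp only [quadEval, quadDeriv, map_add, map_sub, map_smul, LinearMap.add_apply,
      LinearMap.sub_apply, LinearMap.smul_apply] at *
  have q4 : G p u + G u p = 0 := by
    have : (2 : F) • (G p u + G u p) = 0 := by
      linear_combination (norm := module) h1 - h1' - (2 : F) • hd
    exact (smul_eq_zero.1 this).resolve_left h2
  have S : (G a p + G p a + l p) + G p p + G u u = 0 := by
    linear_combination (norm := module) h1 - h0 - hd - q4
  -- By `h0`, `hd`, `q4` and `S`, the value at `(s,t)` is `(s² - s)G(p,p) + (t² - s)G(u,u)`. The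
  -- tangent condition at `(1,1)` gives `R`, after which `α` times this value is the conic equation
  -- times `G(u,u)`. For `α = 0`, `R` gives `G(u,u) = 0` and the conic gives `s² = s`.
  have R : α • G p p = (1 - α) • G u u := by
    have : (2 : F) • (α • G p p) = (2 : F) • ((1 - α) • G u u) := by
      linear_combination (norm := module) -hd' + (1 - 2 * α) • hd + (1 - 4 * α) • q4 - (2 * α) • S
    rw [← sub_eq_zero, ← smul_sub] at this
    exact sub_eq_zero.1 ((smul_eq_zero.1 this).resolve_left h2)
  by_cases hα : α = 0
  · subst hα
    have hu : G u u = 0 := by simpa using R.symm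
    have hs : s - s ^ 2 = 0 := by linear_combination -hst
    rw [hu] at S
    have hp : (s - s ^ 2) • G p p = 0 := by rw [hs, zero_smul]
    linear_combination (norm := module) h0 + t • hd + (s * t) • q4 + (t ^ 2) • hu + s • S - hp
  · have hu : (α * t ^ 2 - (s - (1 - α) * s ^ 2)) • G u u = 0 := by rw [hst, sub_self, zero_smul]
    rw [← smul_eq_zero_iff_right hα]
    linear_combination (norm := module) α • h0 + (α * t) • hd + (α * s * t) • q4 + (α * s) • S + hu
      + (s ^ 2 - s) • R

end Interpolation

end Identities

/-! ### The line through two axes, and the derivation property. -/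

section Frame

variable {F A : Type*} [Field F] [NonUnitalNonAssocCommRing A] [Module F A]
  [SMulCommClass F A A] [IsScalarTower F A A]

/-- Multiplication table of the line through the primitive axes `a` and `b`, in terms of the
components `b = α a + z + u` of `b` in the eigenspaces of `a`. -/
structure LineFrame (B : A →ₗ[F] A →ₗ[F] F) (a b z u : A) (α : F) : Prop where
  form : IsFrobeniusForm B
  two : (2 : F) ≠ 0
  fst : IsPrimitiveAxis F a
  snd : IsPrimitiveAxis F b
  snd_eq : b = α • a + z + u
  fst_zero : a * z = 0
  fst_half : a * u = (2⁻¹ : F) • u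
  zero_zero : z * z = (1 - α) • z
  zero_half : z * u = ((1 - α) * 2⁻¹) • u
  half_half : u * u = (α * (1 - α)) • a + α • z
  form_fst_snd : B a b = α

namespace LineFrame

variable {B : A →ₗ[F] A →ₗ[F] F} {a b z u : A} {α : F}

lemma form_fst_zero (L : LineFrame B a b z u α) : B a z = 0 := by
  rw [L.form.axis a L.fst, L.fst.coord_zero L.two L.fst_zero]

lemma form_fst_half (L : LineFrame B a b z u α) : B a u = 0 := by
  rw [L.form.axis a L.fst, L.fst.coord_half L.two L.fst_half]

lemma form_fst_fst (L : LineFrame B a b z u α) : B a a = 1 := by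
  rw [L.form.axis a L.fst, L.fst.coord_self L.two]

lemma snd_eq' (L : LineFrame B a b z u α) : a + (z - (1 - α) • a) + u = b := by
  rw [L.snd_eq]; module

lemma fst_snd (L : LineFrame B a b z u α) : a * b = α • a + (2⁻¹ : F) • u := by
  rw [L.snd_eq, mul_add, mul_add, mul_smul_comm, L.fst.idem, L.fst_zero, L.fst_half, add_zero]

lemma mem_line_fst : a ∈ line F a b := NonUnitalAlgebra.subset_adjoin F (by simp)

lemma mem_line_snd : b ∈ line F a b := NonUnitalAlgebra.subset_adjoin F (by simp)

lemma mem_line_half (L : LineFrame B a b z u α) : u ∈ line F a b := by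
  have : u = (2 : F) • (a * b - α • a) := by
    rw [L.fst_snd, add_sub_cancel_left, half_add_half L.two]
  rw [this]
  exact SMulMemClass.smul_mem _ (sub_mem (mul_mem mem_line_fst mem_line_snd)
    (SMulMemClass.smul_mem _ mem_line_fst))

lemma mem_line_zero (L : LineFrame B a b z u α) : z ∈ line F a b := by
  have : z = b - α • a - u := by rw [L.snd_eq]; abel
  rw [this]
  exact sub_mem (sub_mem mem_line_snd (SMulMemClass.smul_mem _ mem_line_fst)) L.mem_line_half

lemma mul_combo (L : LineFrame B a b z u α) (k s t k' s' t' : F) :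
    (k • a + s • z + t • u) * (k' • a + s' • z + t' • u)
      = (k * k' + t * t' * (α * (1 - α))) • a + (s * s' * (1 - α) + t * t' * α) • z
        + (2⁻¹ * (k * t' + t * k' + (1 - α) * (s * t' + t * s'))) • u := by
  simp only [add_mul, mul_add, smul_mul_assoc, mul_smul_comm, L.fst.idem, L.fst_zero,
    L.fst_half, mul_comm z a, mul_comm u a, mul_comm u z, L.zero_half, L.zero_zero, L.half_half]
  have := L.two
  match_scalars <;> field_simp <;> ring

lemma exists_combo (L : LineFrame B a b z u α) {x : A} (hx : x ∈ line F a b) :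
    ∃ k s t : F, x = k • a + s • z + t • u := by
  induction hx using NonUnitalAlgebra.adjoin_induction with
  | mem x hx =>
    rcases hx with rfl | hx
    · exact ⟨1, 0, 0, by simp⟩
    · rw [Set.mem_singleton_iff] at hx
      subst hx
      exact ⟨α, 1, 1, by rw [one_smul, one_smul]; exact L.snd_eq⟩
  | add x y _ _ h h' =>
    obtain ⟨k, s, t, rfl⟩ := h
    obtain ⟨k', s', t', rfl⟩ := h'
    exact ⟨k + k', s + s', t + t', by module⟩
  | zero => exact ⟨0, 0, 0, by simp⟩
  | mul x y _ _ h h' =>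
    obtain ⟨k, s, t, rfl⟩ := h
    obtain ⟨k', s', t', rfl⟩ := h'
    exact ⟨_, _, _, L.mul_combo k s t k' s' t'⟩
  | smul r x _ h =>
    obtain ⟨k, s, t, rfl⟩ := h
    exact ⟨r * k, r * s, r * t, by module⟩

lemma miyamoto_fst (L : LineFrame B a b z u α) (s t : F) :
    miyamoto F a (a + s • (z - (1 - α) • a) + t • u) = a + s • (z - (1 - α) • a) - t • u := by
  rw [L.form.miyamoto_eq L.two L.fst]
  simp only [map_add, map_sub, map_smul, L.form_fst_zero, L.form_fst_half, L.form_fst_fst,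
    mul_add, mul_sub, mul_smul_comm, L.fst_zero, L.fst_half, L.fst.idem, smul_eq_mul]
  have := L.two
  match_scalars <;> field_simp <;> ring

/-- The first identity linearised at `a` in the direction `u`; this one holds without any hypothesis
on `D_{a,b}`. -/
lemma mul_sq_deriv (L : LineFrame B a b z u α) (x : A) :
    a * (u * x) + u * (a * x) = (2⁻¹ : F) • (u * x) + (2⁻¹ * B u x) • a + (2⁻¹ * B a x) • u := by
  have h2 := L.two
  obtain ⟨p, y, hx, hp, hy⟩ := L.fst.exists_peirce h2 x
  have hu : u ∈ eig F a 2⁻¹ := mem_eig.2 L.fst_half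
  have hp' := mem_eig.1 (L.fst.zero_half p (mem_eig.2 (by simpa using hp)) u hu)
  rw [mul_comm p u] at hp'
  obtain ⟨q, hq, r, hr, hqr⟩ := Submodule.mem_sup.1
    (L.fst.half_half u hu y (mem_eig.2 hy))
  rw [L.fst.primitive, Submodule.mem_span_singleton] at hq
  obtain ⟨m, rfl⟩ := hq
  rw [mem_eig, zero_smul] at hr
  have hau : a * (u * y) = m • a := by rw [← hqr, mul_add, mul_smul_comm, L.fst.idem, hr, add_zero]
  have hBap : B a p = 0 := by rw [L.form.axis a L.fst, L.fst.coord_zero L.two hp]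
  have hBar : B a r = 0 := by rw [L.form.axis a L.fst, L.fst.coord_zero L.two hr]
  have hBay : B a y = 0 := by rw [L.form.axis a L.fst, L.fst.coord_half L.two hy]
  have hm : m = 2⁻¹ * B u y := by
    have := L.form.assoc a u y
    rw [← hqr, map_add, map_smul, hBar, L.form_fst_fst, L.fst_half, map_smul] at this
    simpa using this.symm
  have hBup : B u p = 0 := by
    have := L.form.assoc u a p
    rw [hp, map_zero, mul_comm u a, L.fst_half, map_smul, LinearMap.smul_apply, smul_eq_mul] at this
    exact (mul_eq_zero.1 this).resolve_left (inv_ne_zero h2)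
  have hBua : B u a = 0 := by rw [L.form.symm, L.form_fst_half]
  rw [hx]
  simp only [mul_add, mul_smul_comm, L.fst.idem, hp, hy, hp', hau, hm, map_add, map_smul,
    hBup, hBua, hBay, hBap, L.form_fst_fst, mul_comm u a, L.fst_half, mul_zero, smul_eq_mul]
  match_scalars <;> field_simp <;> ring

/-- As `z` lies in the `0`-eigenspace of `a`, `L_z` commutes with `L_a`, so only the component `u`
of `b` contributes to the commutator. -/
lemma D_eq (L : LineFrame B a b z u α) (x : A) : D F a b x = a * (u * x) - u * (a * x) := by
  have h2 := L.two
  have hz : a * (z * x) = z * (a * x) := by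
    obtain ⟨p, y, hx, hp, hy⟩ := L.fst.exists_peirce h2 x
    have mz : z ∈ eig F a 0 := mem_eig.2 (by simpa using L.fst_zero)
    have h1 := mem_eig.1 (L.fst.zero_zero z mz p (mem_eig.2 (by simpa using hp)))
    have h3 := mem_eig.1 (L.fst.zero_half z mz y (mem_eig.2 hy))
    rw [hx]
    simp only [mul_add, mul_smul_comm, L.fst.idem, hp, hy, h1, h3, mul_comm z a, L.fst_zero]
    simp
  have : D F a b x = a * (b * x) - b * (a * x) := rfl
  rw [this, L.snd_eq]
  simp only [add_mul, mul_add, smul_mul_assoc, mul_smul_comm, hz]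
  abel

/-- Together with `D_snd`: the values of `D_{a,b}` at `a` and `b` are tangent to the conic `αt² = s
- (1-α)s²` at `(0,0)` and `(1,1)`. -/
lemma D_fst (L : LineFrame B a b z u α) : (4 : F) • D F a b a = -u := by
  have h2 := L.two
  have h4 := four_ne_zero_of_two h2
  rw [L.D_eq, L.fst.idem, mul_comm u a, L.fst_half, mul_smul_comm, L.fst_half]
  match_scalars
  field_simp
  ring

lemma D_snd (L : LineFrame B a b z u α) :
    (4 : F) • D F a b b = (-2 * α) • (z - (1 - α) • a) + (1 - 2 * α) • u := by
  have h2 := L.two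
  have h4 := four_ne_zero_of_two h2
  have e := L.D_eq b
  rw [e, L.fst_snd, mul_comm u b, L.snd_eq]
  simp only [add_mul, mul_add, smul_mul_assoc, mul_smul_comm, L.fst.idem, L.fst_zero,
    L.fst_half, mul_comm u a, L.zero_half, L.half_half]
  match_scalars <;> field_simp <;> ring

lemma D_skew (hB : IsFrobeniusForm B) (x y : A) : B (D F a b x) y = -B x (D F a b y) := by
  have e (x : A) : D F a b x = a * (b * x) - b * (a * x) := rfl
  have h (a x y : A) : B (a * x) y = B x (a * y) := by rw [mul_comm, hB.assoc]
  rw [e, e, map_sub, map_sub, LinearMap.sub_apply, h, h, h, h]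
  ring

/-- The infinitesimal form of multiplicativity of the Miyamoto maps along the line. -/
lemma isDerivation_of_deriv (L : LineFrame B a b z u α)
    (h : ∀ x y, quadDeriv (mulQuad B x y) (mulLin x y) a u = 0) : IsDerivation (D F a b) := by
  have h2 := L.two
  set T := miyamoto F a
  have Teq (x : A) : T x = x - (4 : F) • (a * x) + (4 * B a x) • a :=
    L.form.miyamoto_eq h2 L.fst x
  have sq := L.form.sq h2 L.fst
  have sqd (x : A) : a * (u * x) = (2⁻¹ : F) • (u * x) + (2⁻¹ * B u x) • a + (2⁻¹ * B a x) • u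
      - u * (a * x) := by rw [← L.mul_sq_deriv]; abel
  have hBaa (x : A) : B a (a * x) = B a x := by rw [← L.form.assoc, L.fst.idem]
  have hBua (x : A) : B u (a * x) = 2⁻¹ * B u x := by
    rw [← L.form.assoc, mul_comm u a, L.fst_half, map_smul]; rfl
  -- The right side is `-1/4` of the derivative of `τ_c x` at `c = a` along `u`. By `hmul` it is a
  -- derivation twisted by `τ_a`; composing with the automorphism `τ_a` removes the twist.
  have hDT (x : A) : (2 : F) • D F a b (T x) = u * x - B u x • a - B a x • u := by
    rw [L.D_eq, Teq]
    simp only [mul_add, mul_sub, mul_smul_comm, sqd, sq, L.fst.idem, L.fst_half, mul_comm u a,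
      hBaa, hBua]
    match_scalars <;> field_simp <;> ring
  have hmul (x y : A) : u * (x * y) - B u (x * y) • a - B a (x * y) • u
      = (u * x - B u x • a - B a x • u) * T y + T x * (u * y - B u y • a - B a y • u) := by
    have := h x y
    rw [mulDeriv_eq] at this
    rw [← sub_eq_zero, ← this, Teq, Teq]
    simp only [mul_add, mul_sub, add_mul, sub_mul, mul_smul_comm, smul_mul_assoc, L.fst.idem,
      L.fst_half, mul_comm x u, mul_comm _ a, mul_comm (a * _) u, mul_comm (a * _) (u * _), sqd, sq]
    match_scalars <;> field_simp <;> ring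
  intro x y
  apply smul_two_cancel h2
  have hTT := L.fst.toIsAxis.miyamoto_miyamoto h2
  have hTm := L.fst.toIsAxis.miyamoto_mul h2
  have ex := hDT (T x)
  have ey := hDT (T y)
  have exy := hDT (T x * T y)
  rw [hTT] at ex ey
  rw [hTm, hTT, hTT, hmul, hTT, hTT, ← ex, ← ey] at exy
  rw [exy, smul_mul_assoc, mul_smul_comm, smul_add]

/-- A further primitive axis on the line in general position makes `D_{a,b}` a derivation. -/
lemma isDerivation_of_axis (L : LineFrame B a b z u α) {s t : F} (ht : t ≠ 0) (hs : s ≠ 1)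
    (hc : IsPrimitiveAxis F (a + s • (z - (1 - α) • a) + t • u)) : IsDerivation (D F a b) := by
  have h2 := L.two
  have key {s t : F} (hc : IsPrimitiveAxis F (a + s • (z - (1 - α) • a) + t • u)) :
      AxisIdentities B (a + s • (z - (1 - α) • a) + t • u) ∧
        AxisIdentities B (a + s • (z - (1 - α) • a) - t • u) := by
    refine ⟨L.form.axisIdentities h2 hc, ?_⟩
    rw [← L.miyamoto_fst]
    exact L.form.axisIdentities h2 (hc.miyamoto h2 L.fst.toIsAxis)
  have hb := key (s := 1) (t := 1) (by rw [one_smul, one_smul, L.snd_eq']; exact L.snd)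
  rw [one_smul, one_smul] at hb
  exact L.isDerivation_of_deriv fun x y => quadDeriv_eq_zero_of_zeros h2 ht hs
    (hb.1.2 x y) (hb.2.2 x y) ((key hc).1.2 x y) ((key hc).2.2 x y)

/-- If `D_{a,b}` is a derivation, then the identities hold on the conic of idempotents. -/
lemma axisIdentities_of_isDerivation (L : LineFrame B a b z u α) (h : IsDerivation (D F a b))
    {s t : F} (hst : α * t ^ 2 = s - (1 - α) * s ^ 2) :
    AxisIdentities B (a + s • (z - (1 - α) • a) + t • u) := by
  have h2 := L.two
  have ha := L.form.axisIdentities h2 L.fst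
  have hb := L.form.axisIdentities h2 L.snd
  have hb' := L.form.axisIdentities h2 (L.snd.miyamoto h2 L.fst.toIsAxis)
  have eb := L.miyamoto_fst 1 1
  rw [one_smul, one_smul, L.snd_eq'] at eb
  rw [eb] at hb'
  have da := ha.deriv_eq_zero h (D_skew L.form)
  have db := hb.deriv_eq_zero h (D_skew L.form)
  have scale {G : A →ₗ[F] A →ₗ[F] A} {l : A →ₗ[F] A} {c d : A} (k : F)
      (h : quadDeriv G l c d = 0) : quadDeriv G l c (k • d) = 0 := by
    have : quadDeriv G l c (k • d) = k • quadDeriv G l c d := by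
      simp only [quadDeriv, map_smul, LinearMap.smul_apply, smul_add]
    rw [this, h, smul_zero]
  have ua {G : A →ₗ[F] A →ₗ[F] A} {l : A →ₗ[F] A} (h : quadDeriv G l a (D F a b a) = 0) :
      quadDeriv G l a u = 0 := by
    have := scale (-1) (scale 4 h)
    rwa [L.D_fst, neg_smul, one_smul, neg_neg] at this
  have ub {G : A →ₗ[F] A →ₗ[F] A} {l : A →ₗ[F] A} (h : quadDeriv G l b (D F a b b) = 0) :
      quadDeriv G l (a + (z - (1 - α) • a) + u)
        ((-2 * α) • (z - (1 - α) • a) + (1 - 2 * α) • u) = 0 := by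
    have := scale 4 h
    rwa [L.D_snd, ← L.snd_eq'] at this
  rw [← L.snd_eq'] at hb
  exact ⟨fun x => quadEval_eq_zero_on_conic h2 hst (ha.1 x) (hb.1 x) (hb'.1 x) (ua (da.1 x))
      (ub (db.1 x)),
    fun x y => quadEval_eq_zero_on_conic h2 hst (ha.2 x y) (hb.2 x y) (hb'.2 x y)
      (ua (da.2 x y)) (ub (db.2 x y))⟩

/-- An idempotent `ka + sz + tu` with `tu ≠ 0` can be written as a point of the conic. If `tu = 0`,
then `k` is `0` or `1`: for `k = 0` it is again on the conic, and for `k = 1` it fixes `a`, so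
primitivity leaves only `a`. -/
lemma isSolid_of_isDerivation (L : LineFrame B a b z u α) (h : IsDerivation (D F a b)) :
    IsSolid F a b := by
  have h2 := L.two
  intro c hc
  suffices hs : c = a ∨ ∃ s t : F, α * t ^ 2 = s - (1 - α) * s ^ 2 ∧
      c = a + s • (z - (1 - α) • a) + t • u by
    rcases hs with rfl | ⟨s, t, hst, hce⟩
    · exact L.fst.toIsAxis
    · refine AxisIdentities.isAxis L.form h2 ?_ hc.ne_zero hc.idem
      rw [hce]
      exact L.axisIdentities_of_isDerivation h hst
  obtain ⟨k, s, t, hce⟩ := L.exists_combo hc.mem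
  have mu := miyamoto_of_half h2 L.fst_half
  have mz : miyamoto F a z = z := miyamoto_of_mem_sup
    (Submodule.mem_sup_right (mem_eig.2 (by simpa using L.fst_zero)))
  have ma : miyamoto F a a = a := miyamoto_of_mem_sup
    (Submodule.mem_sup_left (mem_eig.2 (by simpa using L.fst.idem)))
  have hcc := hc.idem
  rw [hce, L.mul_combo] at hcc
  obtain ⟨e1, e3⟩ := IsAxis.odd_even_ext (a := a) h2
    (by simp only [map_add, map_smul, ma, mz]) (by simp only [map_add, map_smul, ma, mz])
    (by rw [map_smul, mu, smul_neg]) (by rw [map_smul, mu, smul_neg]) hcc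
  have e2 := congrArg (B a) e1
  simp only [map_add, map_smul, L.form_fst_fst, L.form_fst_zero, smul_eq_mul, mul_zero,
    add_zero, mul_one] at e2
  rw [e2] at e1
  have e4 := add_left_cancel e1
  have e5 : (k + (1 - α) * s - 1) • t • u = 0 := by
    rw [smul_smul, ← sub_eq_zero.2 e3]
    match_scalars
    field_simp
    ring
  by_cases htu : t • u = 0
  · have h0 : (t * t) • (u * u) = 0 := by rw [← smul_mul_smul_comm, htu, zero_mul]
    rw [L.half_half] at h0
    have h1 := congrArg (B a) h0
    simp only [map_add, map_smul, L.form_fst_fst, L.form_fst_zero, smul_eq_mul, mul_zero,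
      add_zero, mul_one, map_zero] at h1
    have h3 : (t * t * α) • z = 0 := by
      have : (t * t * α) • z = (t * t) • ((α * (1 - α)) • a + α • z)
        - (t * t * (α * (1 - α))) • a := by module
      rw [this, h0, h1, zero_smul, sub_zero]
    rw [htu, add_zero] at hce
    have hk : k * (k - 1) = 0 := by linear_combination e2 - h1
    rcases mul_eq_zero.1 hk with hk | hk
    · right
      rw [hk, zero_smul, zero_add] at hce
      have hs : s ≠ 0 := fun h => hc.ne_zero (by rw [hce, h, zero_smul])
      have hz : z ≠ 0 := fun h => hc.ne_zero (by rw [hce, h, smul_zero])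
      have h5 := smul_ne_zero_inj hz e4
      have h6 := (smul_eq_zero.1 h3).resolve_right hz
      have h7 : s * (1 - α) = 1 := by
        apply mul_left_cancel₀ hs
        linear_combination h5 - h6
      refine ⟨s, 0, by linear_combination s * h7, ?_⟩
      rw [hce]
      match_scalars
      · ring
      · linear_combination h7
      · ring
    · left
      have hk : k = 1 := by linear_combination hk
      rw [hk, one_smul] at hce
      have hca : c * a = a := by
        rw [hce, mul_comm, mul_add, mul_smul_comm, L.fst_zero, L.fst.idem, smul_zero, add_zero]
      obtain ⟨m, hm⟩ := Submodule.mem_span_singleton.1 (hc.primitive a mem_line_fst hca)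
      have h8 := congrArg (B a) hm
      rw [hce] at h8
      simp only [map_add, map_smul, L.form_fst_fst, L.form_fst_zero, smul_eq_mul, mul_zero,
        add_zero, mul_one] at h8
      rw [← hm, h8, one_smul]
  · right
    have hu0 : u ≠ 0 := fun h => htu (by rw [h, smul_zero])
    have e5 := (smul_eq_zero.1 e5).resolve_right htu
    by_cases hz : z = 0
    · have hzu := L.zero_half
      rw [hz, zero_mul] at hzu
      have hα := (smul_eq_zero.1 hzu.symm).resolve_right hu0
      have hα : 1 - α = 0 := (mul_eq_zero.1 hα).resolve_right (inv_ne_zero h2)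
      -- Here `z = 0` and `α = 1`, so `s` is immaterial and is chosen to satisfy the conic equation.
      refine ⟨t ^ 2, t, by linear_combination (-t ^ 2 + t ^ 4) * hα, ?_⟩
      rw [hce, hz, hα]
      have : k = 1 := by linear_combination e5 - s * hα
      rw [this]; simp
    · have hs := smul_ne_zero_inj hz e4
      refine ⟨s, t, by linear_combination hs, ?_⟩
      rw [hce]
      have : k = 1 - (1 - α) * s := by linear_combination e5
      rw [this]; module

lemma form_snd_fst (L : LineFrame B a b z u α) : B b a = α := by
  rw [L.form.symm, L.form_fst_snd]

lemma miyamoto_snd_fst (L : LineFrame B a b z u α) :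
    miyamoto F b a = a + (4 * α) • (z - (1 - α) • a) + (4 * α - 2) • u := by
  have h2 := L.two
  rw [L.form.miyamoto_eq h2 L.snd, L.form_snd_fst, mul_comm b a, L.fst_snd, L.snd_eq]
  match_scalars <;> field_simp <;> ring

/-- The axis `τ_b a` is the point `(4α, 4α - 2)`, in general position exactly under the two
inequalities. -/
lemma isDerivation_of_generic (L : LineFrame B a b z u α) (h1 : 2 * α ≠ 1) (h3 : 4 * α ≠ 1) :
    IsDerivation (D F a b) := by
  have hc := L.fst.miyamoto L.two L.snd.toIsAxis
  rw [L.miyamoto_snd_fst] at hc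
  refine L.isDerivation_of_axis ?_ h3 hc
  intro h
  apply h1
  apply mul_left_cancel₀ L.two
  linear_combination h

/-- If the complementary idempotent of `a` on the line is an axis, it is primitive. -/
lemma isPrimitiveAxis_compl (L : LineFrame B a b z u α) (h1 : 1 - α ≠ 0) (h3 : 2 * α ≠ 1)
    {e : A} (hze : z = (1 - α) • e) (he : IsAxis F e) : IsPrimitiveAxis F e := by
  have h2 := L.two
  refine ⟨he, le_antisymm (fun x hx => ?_) ?_⟩
  · have hae : a * e = 0 := by
      have := L.fst_zero
      rw [hze, mul_smul_comm] at this
      exact (smul_eq_zero.1 this).resolve_left h1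
    have heu : e * u = (2⁻¹ : F) • u := by
      have := L.zero_half
      rw [hze, smul_mul_assoc, mul_smul] at this
      exact smul_right_injective A h1 this
    have hax : a * x = 0 := by
      rw [mul_comm]
      exact he.one_zero x hx a (mem_eig.2 (by rw [mul_comm, hae, zero_smul]))
    have hux := he.one_half x hx u (mem_eig.2 heu)
    rw [mul_comm, mem_eig] at hux
    rw [mem_eig, one_smul] at hx
    have haux := L.fst.zero_half x (mem_eig.2 (by simpa using hax)) u (mem_eig.2 L.fst_half)
    rw [mul_comm, mem_eig] at haux
    have hu := miyamoto_of_half h2 L.fst_half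
    have hBu : B u x = 0 := by
      have := L.form.assoc u a x
      rw [hax, map_zero, mul_comm u a, L.fst_half, map_smul, LinearMap.smul_apply,
        smul_eq_mul] at this
      exact (mul_eq_zero.1 this).resolve_left (inv_ne_zero h2)
    have hBa : B a x = 0 := by rw [L.form.axis a L.fst, L.fst.coord_zero h2 hax]
    have hxx : miyamoto F a x = x :=
      miyamoto_of_mem_sup (Submodule.mem_sup_right (mem_eig.2 (by simpa using hax)))
    have hee : miyamoto F a e = e :=
      miyamoto_of_mem_sup (Submodule.mem_sup_right (mem_eig.2 (by simpa using hae)))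
    have haa : miyamoto F a a = a :=
      miyamoto_of_mem_sup (Submodule.mem_sup_left (mem_eig.2 (by simpa using L.fst.idem)))
    have hm := L.fst.toIsAxis.miyamoto_mul h2
    have huu : u * u = (α * (1 - α)) • (a + e) := by rw [L.half_half, hze]; module
    -- This identity for `b` at `x` is split by parity over `a`: the odd part gives `ux = (e,x)u/2`,
    -- and then the even part gives `(1-α)(1-2α)(x - (e,x)e) = 0`.
    have hsq := L.form.sq h2 L.snd x
    have hBb : B b x = (1 - α) * B e x := by
      rw [L.snd_eq, hze]
      simp [hBu, hBa]
    have hbx : b * x = (1 - α) • x + u * x := by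
      rw [L.snd_eq, hze]
      simp only [add_mul, smul_mul_assoc, hax, hx, smul_zero, zero_add]
    rw [hBb, hbx, L.snd_eq, hze] at hsq
    have hsq' : ((1 - α) ^ 2 • x + u * (u * x)) + (1 - α + 2⁻¹) • (u * x)
        = ((2⁻¹ * (1 - α)) • x + (2⁻¹ * (1 - α) * B e x) • (α • a + (1 - α) • e))
          + ((2⁻¹ : F) • (u * x) + (2⁻¹ * (1 - α) * B e x) • u) := by
      have : ((1 - α) ^ 2 • x + u * (u * x)) + (1 - α + 2⁻¹) • (u * x)
          = (α • a + (1 - α) • e + u) * ((1 - α) • x + u * x) := by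
        simp only [add_mul, mul_add, smul_mul_assoc, mul_smul_comm, hax, hx, hux, haux]
        match_scalars <;> field_simp <;> ring
      rw [this, hsq]
      module
    obtain ⟨h5, h6⟩ := IsAxis.odd_even_ext (a := a) h2
      (by simp only [map_add, map_smul, hm, hxx, hu, neg_mul, mul_neg, neg_neg])
      (by simp only [map_add, map_smul, hxx, haa, hee])
      (by simp only [map_smul, hm, hxx, hu, neg_mul, smul_neg])
      (by simp only [map_add, map_smul, hm, hxx, hu, neg_mul, smul_neg, neg_add]) hsq'
    have h7 : u * x = (2⁻¹ * B e x) • u := by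
      apply smul_right_injective A h1
      change (1 - α) • (u * x) = (1 - α) • (2⁻¹ * B e x) • u
      linear_combination (norm := module) h6
    rw [h7, mul_smul_comm, huu] at h5
    have h8 : ((1 - α) * (1 - 2 * α)) • x = ((1 - α) * (1 - 2 * α)) • B e x • e := by
      have h9 : ((1 - α) * (1 - 2 * α)) • x
          = (2 : F) • ((1 - α) ^ 2 • x) - (1 - α) • x := by module
      rw [h9, eq_sub_of_add_eq h5]
      match_scalars <;> field_simp <;> ring
    rw [Submodule.mem_span_singleton]
    exact ⟨B e x, (smul_right_injective A
      (mul_ne_zero h1 (sub_ne_zero.2 (Ne.symm h3))) h8).symm⟩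
  · rw [Submodule.span_singleton_le_iff_mem, mem_eig, one_smul, he.idem]

/-- Now `τ_b a = τ_a b` gives nothing new. Solidity makes the complementary idempotent `e = z/(1-α)`
an axis, and `τ_b e` is the point with `s = (1-2α)²/(1-α)` and `t = 2 - 4α`, which is in general
position. -/
lemma isDerivation_of_quarter (L : LineFrame B a b z u α) (h4 : 4 * α = 1) (h1 : 1 - α ≠ 0)
    (hs : IsSolid F a b) : IsDerivation (D F a b) := by
  have h2 := L.two
  have hα0 : α ≠ 0 := by rintro rfl; simp at h4
  have hα2 : 2 * α ≠ 1 := by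
    intro h
    apply one_ne_zero (α := F)
    linear_combination h4 - 2 * h
  obtain ⟨e, hze⟩ : ∃ e, z = (1 - α) • e := ⟨(1 - α)⁻¹ • z, by rw [smul_inv_smul₀ h1]⟩
  have hae : a * e = 0 := by
    have := L.fst_zero
    rw [hze, mul_smul_comm] at this
    exact (smul_eq_zero.1 this).resolve_left h1
  have heu : e * u = (2⁻¹ : F) • u := by
    have := L.zero_half
    rw [hze, smul_mul_assoc, mul_smul] at this
    exact smul_right_injective A h1 this
  have hee : e * e = e := by
    have := L.zero_zero
    rw [hze, smul_mul_smul_comm, mul_smul] at this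
    exact smul_right_injective A h1 (smul_right_injective A h1 this)
  have he0 : e ≠ 0 := by
    intro h0
    rw [h0, zero_mul] at heu
    have hu : u = 0 := (smul_eq_zero.1 heu.symm).resolve_left (inv_ne_zero h2)
    have := L.half_half
    rw [hze, hu, h0, mul_zero, smul_zero, smul_zero, add_zero] at this
    exact (mul_ne_zero hα0 h1) ((smul_eq_zero.1 this.symm).resolve_right L.fst.ne_zero)
  have he : IsPrimitiveIdempotentOf (line F a b) e := by
    refine ⟨?_, he0, hee, fun x hx hex => ?_⟩
    · have : e = (1 - α)⁻¹ • z := by rw [hze, inv_smul_smul₀ h1]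
      rw [this]
      exact SMulMemClass.smul_mem _ L.mem_line_zero
    · obtain ⟨k, s, t, rfl⟩ := L.exists_combo hx
      have mu := miyamoto_of_half h2 L.fst_half
      have me : miyamoto F a e = e := miyamoto_of_mem_sup
        (Submodule.mem_sup_right (mem_eig.2 (by simpa using hae)))
      have ma : miyamoto F a a = a := miyamoto_of_mem_sup
        (Submodule.mem_sup_left (mem_eig.2 (by simpa using L.fst.idem)))
      rw [hze] at hex ⊢
      simp only [mul_add, mul_smul_comm, mul_comm e a, hae, hee, heu, smul_zero, zero_add] at hex
      obtain ⟨e1, e2⟩ := IsAxis.odd_even_ext (a := a) h2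
        (by simp only [map_smul, me]) (by simp only [map_add, map_smul, ma, me])
        (by simp only [map_smul, mu, smul_neg]) (by simp only [map_smul, mu, smul_neg]) hex
      have e3 : t • u = 0 := by
        have : t • u = (2 : F) • (t • u - t • (2⁻¹ : F) • u) := by
          match_scalars; field_simp; ring
        rw [this, e2, sub_self, smul_zero]
      rw [e3, ← e1, add_zero, Submodule.mem_span_singleton]
      exact ⟨s * (1 - α), by rw [mul_smul]⟩
  have hpe := L.isPrimitiveAxis_compl h1 hα2 hze (hs e he)
  have hBee : B e e = 1 := by rw [L.form.axis e hpe, hpe.coord_self h2]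
  have hBeu : B e u = 0 := by rw [L.form.axis e hpe, hpe.coord_half h2 heu]
  have hBea : B e a = 0 := by rw [L.form.axis e hpe, hpe.coord_zero h2 (by rw [mul_comm, hae])]
  have hBbe : B b e = 1 - α := by
    rw [L.form.symm, L.snd_eq, hze]
    simp [hBee, hBeu, hBea]
  have hc := hpe.miyamoto h2 L.snd.toIsAxis
  have hce : miyamoto F b e = a + ((1 - 2 * α) ^ 2 * (1 - α)⁻¹) • (z - (1 - α) • a)
      + (2 - 4 * α) • u := by
    rw [L.form.miyamoto_eq h2 L.snd, hBbe, L.snd_eq, hze]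
    simp only [add_mul, smul_mul_assoc, hae, hee, mul_comm u e, heu]
    match_scalars <;> field_simp <;> ring
  rw [hce] at hc
  refine L.isDerivation_of_axis (fun h => ?_) (fun h => ?_) hc
  · exact hα2 (mul_left_cancel₀ h2 (by linear_combination -h))
  · have : (1 - 2 * α) ^ 2 = 1 - α := by
      field_simp at h
      exact h
    have h5 : 2 * α = 0 := by linear_combination α * h4 - this
    exact (mul_ne_zero h2 hα0) h5

lemma isDerivation_of_one (L : LineFrame B a b z u 1) {r : F} (hr : r ≠ 0) (hr1 : r ^ 2 ≠ 1)
    (hs : IsSolid F a b) : IsDerivation (D F a b) := by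
  have h2 := L.two
  -- On the parabola `s = t²`, reflecting `a` in the point of parameter `t` gives parameter `2t`, so
  -- the auxiliary idempotent is taken at `r/2`.
  obtain ⟨t, rfl⟩ : ∃ t, r = 2 * t := ⟨2⁻¹ * r, by field_simp⟩
  set c := a + (t ^ 2) • z + t • u with hc
  have hcc : c * c = c := by
    have := L.mul_combo 1 (t ^ 2) t 1 (t ^ 2) t
    rw [one_smul] at this
    rw [hc, this]
    match_scalars <;> field_simp <;> ring
  have hBc : B a c = 1 := by
    simp [hc, L.form_fst_fst, L.form_fst_zero, L.form_fst_half]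
  have hcp : IsPrimitiveIdempotentOf (line F a b) c := by
    refine ⟨?_, ?_, hcc, fun x hx hcx => ?_⟩
    · exact add_mem (add_mem mem_line_fst (SMulMemClass.smul_mem _ L.mem_line_zero))
        (SMulMemClass.smul_mem _ L.mem_line_half)
    · intro h
      rw [h, map_zero] at hBc
      exact zero_ne_one hBc
    · obtain ⟨k, s, q, rfl⟩ := L.exists_combo hx
      have mu := miyamoto_of_half h2 L.fst_half
      have mz : miyamoto F a z = z := miyamoto_of_mem_sup
        (Submodule.mem_sup_right (mem_eig.2 (by simpa using L.fst_zero)))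
      have ma : miyamoto F a a = a := miyamoto_of_mem_sup
        (Submodule.mem_sup_left (mem_eig.2 (by simpa using L.fst.idem)))
      have := L.mul_combo 1 (t ^ 2) t k s q
      rw [one_smul] at this
      rw [hc, this] at hcx
      obtain ⟨e1, e2⟩ := IsAxis.odd_even_ext (a := a) h2
        (by simp only [map_add, map_smul, ma, mz]) (by simp only [map_add, map_smul, ma, mz])
        (by simp only [map_smul, mu, smul_neg]) (by simp only [map_smul, mu, smul_neg]) hcx
      have huu : u * u = z := by rw [L.half_half]; simp
      have e3 : q • u = (t * k) • u := by
        have : q • u - (t * k) • u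
            = (2 : F) • (q • u - (2⁻¹ * (1 * q + t * k + (1 - 1) * (t ^ 2 * q + t * s))) • u) := by
          match_scalars; field_simp; ring
        rw [e2, sub_self, smul_zero, sub_eq_zero] at this
        exact this
      have e4 : (t * q) • z = (t ^ 2 * k) • z := by
        calc (t * q) • z = t • (u * (q • u)) := by rw [mul_smul_comm, huu, mul_smul]
          _ = _ := by rw [e3, mul_smul_comm, huu]; module
      have e5 : s • z = (t * q) • z := by
        linear_combination (norm := module) -e1
      rw [e5, e4, e3, Submodule.mem_span_singleton]
      exact ⟨k, by rw [hc]; module⟩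
  have hT := L.fst.miyamoto h2 (hs c hcp)
  have e : miyamoto F c a = a + ((2 * t) ^ 2) • (z - (1 - 1 : F) • a) + (2 * t) • u := by
    have e1 := L.mul_combo 1 (t ^ 2) t 1 0 0
    rw [one_smul, ← hc, zero_smul, add_zero, zero_smul, add_zero] at e1
    rw [miyamoto_apply, e1, hc]
    have e2 := L.mul_combo 1 (t ^ 2) t
    rw [one_smul] at e2
    rw [e2]
    match_scalars <;> field_simp <;> ring
  rw [e] at hT
  exact L.isDerivation_of_axis hr hr1 hT

end LineFrame

end Frame

/-! ### Two orthogonal axes exchanged by a third: the case `α = 1/2`. -/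

section Orthogonal

variable {F A : Type*} [Field F] [NonUnitalNonAssocCommRing A] [Module F A]
  [SMulCommClass F A A] [IsScalarTower F A A]

/-- Orthogonal primitive axes `a`, `e` interchanged by a third one `b = (a + e) / 2 + u`. -/
structure OrthoFrame (B : A →ₗ[F] A →ₗ[F] F) (a e b u : A) : Prop where
  form : IsFrobeniusForm B
  two : (2 : F) ≠ 0
  fst : IsPrimitiveAxis F a
  snd : IsPrimitiveAxis F e
  mid : IsPrimitiveAxis F b
  fst_snd : a * e = 0
  fst_half : a * u = (2⁻¹ : F) • u
  snd_half : e * u = (2⁻¹ : F) • u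
  mid_eq : b = (2⁻¹ : F) • (a + e) + u

namespace OrthoFrame

variable {B : A →ₗ[F] A →ₗ[F] F} {a e b u : A}

lemma swap (L : OrthoFrame B a e b u) : OrthoFrame B e a b u :=
  ⟨L.form, L.two, L.snd, L.fst, L.mid, by rw [mul_comm, L.fst_snd], L.snd_half, L.fst_half,
    by rw [add_comm e a]; exact L.mid_eq⟩

lemma form_mul (L : OrthoFrame B a e b u) (c x y : A) : B (c * x) y = B x (c * y) := by
  rw [mul_comm, L.form.assoc]

lemma form_zero (L : OrthoFrame B a e b u) {x : A} (hx : a * x = 0) : B a x = 0 := by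
  rw [L.form.axis a L.fst, L.fst.coord_zero L.two hx]

lemma form_half (L : OrthoFrame B a e b u) {x : A} (hx : a * x = (2⁻¹ : F) • x) : B a x = 0 := by
  rw [L.form.axis a L.fst, L.fst.coord_half L.two hx]

lemma form_self (L : OrthoFrame B a e b u) : B a a = 1 := by
  rw [L.form.axis a L.fst, L.fst.coord_self L.two]

lemma form_half_zero (L : OrthoFrame B a e b u) {x y : A} (hx : a * x = (2⁻¹ : F) • x)
    (hy : a * y = 0) : B x y = 0 := by
  have := L.form_mul a x y
  rw [hx, hy, map_zero, map_smul, LinearMap.smul_apply, smul_eq_mul] at this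
  exact (mul_eq_zero.1 this).resolve_left (inv_ne_zero L.two)

lemma miyamoto_apply (L : OrthoFrame B a e b u) (x : A) :
    miyamoto F b x = x - (2 : F) • (a * x + e * x) - (4 : F) • (u * x)
      + (4 * (2⁻¹ * (B a x + B e x) + B u x)) • b := by
  have h2 := L.two
  rw [L.form.miyamoto_eq L.two L.mid]
  have : B b x = 2⁻¹ * (B a x + B e x) + B u x := by
    rw [L.mid_eq]; simp [mul_add]
  rw [this]
  nth_rewrite 1 [L.mid_eq]
  simp only [add_mul, smul_mul_assoc]
  match_scalars <;> field_simp <;> ring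

lemma miyamoto_fst (L : OrthoFrame B a e b u) : miyamoto F b a = e := by
  have h2 := L.two
  rw [L.miyamoto_apply, L.fst.idem, mul_comm e, L.fst_snd, mul_comm u, L.fst_half, L.form_self,
    L.form.symm e, L.form_zero L.fst_snd, L.form.symm u, L.form_half L.fst_half, L.mid_eq]
  match_scalars <;> field_simp <;> ring

/-- Because `τ_b` exchanges `a` and `e`, it exchanges their joint eigenspaces for `(1/2, 0)` and
`(0, 1/2)`. -/
lemma mul_miyamoto (L : OrthoFrame B a e b u) (x : A) :
    a * miyamoto F b x = miyamoto F b (e * x) := by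
  rw [L.mid.toIsAxis.miyamoto_mul L.two, L.swap.miyamoto_fst]

lemma miyamoto_isometry (L : OrthoFrame B a e b u) (x y : A) :
    B (miyamoto F b x) (miyamoto F b y) = B x y := by
  have h (x y : A) : B (miyamoto F b x) y = B x (miyamoto F b y) := by
    rw [L.form.miyamoto_eq L.two L.mid, L.form.miyamoto_eq L.two L.mid]
    simp only [map_add, map_sub, map_smul, LinearMap.add_apply, LinearMap.sub_apply,
      LinearMap.smul_apply, L.form_mul, smul_eq_mul, L.form.symm x b]
    ring
  rw [h, L.mid.toIsAxis.miyamoto_miyamoto L.two]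

lemma mul_mul_comm (L : OrthoFrame B a e b u) (x : A) : a * (e * x) = e * (a * x) := by
  obtain ⟨p, y, hx, hp, hy⟩ := L.fst.exists_peirce L.two x
  have me : e ∈ eig F a 0 := mem_eig.2 (by simpa using L.fst_snd)
  have h1 := mem_eig.1 (L.fst.zero_zero e me p (mem_eig.2 (by simpa using hp)))
  have h3 := mem_eig.1 (L.fst.zero_half e me y (mem_eig.2 hy))
  rw [hx]
  simp only [mul_add, mul_smul_comm, L.fst.idem, hp, hy, h1, h3, mul_comm e a, L.fst_snd]
  simp

lemma miyamoto_half (L : OrthoFrame B a e b u) {x : A} (hx : a * x = (2⁻¹ : F) • x) :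
    miyamoto F a x = -x := miyamoto_of_half L.two hx

lemma miyamoto_self (L : OrthoFrame B a e b u) : miyamoto F a a = a :=
  miyamoto_of_mem_sup (Submodule.mem_sup_left (mem_eig.2 (by simpa using L.fst.idem)))

lemma half_mul_zero (L : OrthoFrame B a e b u) {x y : A} (hx : a * x = (2⁻¹ : F) • x)
    (hy : a * y = 0) : a * (x * y) = (2⁻¹ : F) • (x * y) := by
  rw [mul_comm x y]
  exact mem_eig.1 (L.fst.zero_half y (mem_eig.2 (by simpa using hy)) x (mem_eig.2 hx))

lemma zero_mul_zero (L : OrthoFrame B a e b u) {x y : A} (hx : a * x = 0)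
    (hy : a * y = 0) : a * (x * y) = 0 := by
  simpa using mem_eig.1 (L.fst.zero_zero x (mem_eig.2 (by simpa using hx)) y
    (mem_eig.2 (by simpa using hy)))

lemma half_mul_half_even (L : OrthoFrame B a e b u) {x y : A} (hx : a * x = (2⁻¹ : F) • x)
    (hy : a * y = (2⁻¹ : F) • y) : miyamoto F a (x * y) = x * y := by
  rw [L.fst.toIsAxis.miyamoto_mul L.two, L.miyamoto_half hx, L.miyamoto_half hy, neg_mul_neg]

/-- `u` annihilates the joint `0`-eigenspace. -/
lemma half_mul_zero_zero (L : OrthoFrame B a e b u) {x : A} (ha : a * x = 0) (he : e * x = 0) :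
    u * x = 0 := by
  have h2 := L.two
  have hT := L.miyamoto_apply x
  rw [ha, he, L.form_zero ha, L.swap.form_zero he, L.form_half_zero L.fst_half ha] at hT
  simp only [add_zero, smul_zero, sub_zero, mul_zero, zero_smul] at hT
  have h1 := L.mul_miyamoto x
  rw [he, map_zero, hT, mul_sub, ha, mul_smul_comm, L.half_mul_zero L.fst_half ha, zero_sub,
    neg_eq_zero, smul_smul] at h1
  exact (smul_eq_zero.1 h1).resolve_left (mul_ne_zero (four_ne_zero_of_two h2) (inv_ne_zero h2))

/-- Both `x` and `τ_b x` are odd for `a`, so the even part of the formula for `τ_b x` must vanish.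
-/
lemma half_mul_half_half (L : OrthoFrame B a e b u) {x : A} (ha : a * x = (2⁻¹ : F) • x)
    (he : e * x = (2⁻¹ : F) • x) : u * x = (2⁻¹ * B u x) • (a + e) := by
  have h2 := L.two
  have h4 := four_ne_zero_of_two h2
  have hT := L.miyamoto_apply x
  have h1 := L.mul_miyamoto x
  rw [he, map_smul] at h1
  rw [ha, he, L.form_half ha, L.swap.form_half he, L.mid_eq] at hT
  have hs : (2 * B u x) • (a + e) - (4 : F) • (u * x) + 0
      = 0 + (miyamoto F ((2⁻¹ : F) • (a + e) + u) x + x - (4 * B u x) • u) := by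
    rw [hT]
    match_scalars <;> field_simp <;> ring
  rw [← L.mid_eq] at hs
  obtain ⟨h5, -⟩ := IsAxis.odd_even_ext (a := a) h2
    (by simp only [map_add, map_sub, map_smul, L.half_mul_half_even L.fst_half ha,
          L.miyamoto_self, miyamoto_of_zero L.fst_snd])
    (map_zero _) (by simp)
    (by rw [map_sub, map_add, map_smul, L.miyamoto_half h1, L.miyamoto_half ha,
          L.miyamoto_half L.fst_half]; module) hs
  refine smul_right_injective A h4 ?_
  change (4 : F) • (u * x) = (4 : F) • (2⁻¹ * B u x) • (a + e)
  rw [← sub_eq_zero.1 h5]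
  match_scalars <;> field_simp <;> ring

lemma form_half_of_half_zero (L : OrthoFrame B a e b u) {x : A} (he : e * x = 0) :
    B u x = 0 := L.swap.form_half_zero L.snd_half he

lemma half_mul_half_zero (L : OrthoFrame B a e b u) {x : A} (ha : a * x = (2⁻¹ : F) • x)
    (he : e * x = 0) : (4 : F) • (u * x) = -miyamoto F b x := by
  have h2 := L.two
  rw [L.miyamoto_apply x, ha, he, L.form_half ha, L.swap.form_zero he,
    L.form_half_of_half_zero he]
  match_scalars <;> field_simp <;> ring

/-- The left side `m` is a joint `1/2`-eigenvector fixed by `τ_b`, while on such vectors `τ_b m = -m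
+ 4(u,m)u`. Hence `m = 2(u,m)u`, and associativity of the form evaluates `(u,m)`. -/
lemma symm_mul_miyamoto (L : OrthoFrame B a e b u) {x y : A} (hax : a * x = (2⁻¹ : F) • x)
    (hex : e * x = 0) (hay : a * y = (2⁻¹ : F) • y) (hey : e * y = 0) :
    x * miyamoto F b y + y * miyamoto F b x = -(B x y) • u := by
  have h2 := L.two
  have h4 := four_ne_zero_of_two h2
  have hTT := L.mid.toIsAxis.miyamoto_miyamoto h2
  have hTm := L.mid.toIsAxis.miyamoto_mul h2
  have hux := L.half_mul_half_zero hax hex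
  have huy := L.half_mul_half_zero hay hey
  have hiso := L.miyamoto_isometry x y
  have hax' : a * miyamoto F b x = 0 := by rw [L.mul_miyamoto, hex, map_zero]
  have hay' : a * miyamoto F b y = 0 := by rw [L.mul_miyamoto, hey, map_zero]
  have hex' : e * miyamoto F b x = (2⁻¹ : F) • miyamoto F b x := by
    rw [L.swap.mul_miyamoto, hax, map_smul]
  have hey' : e * miyamoto F b y = (2⁻¹ : F) • miyamoto F b y := by
    rw [L.swap.mul_miyamoto, hay, map_smul]
  set m := x * miyamoto F b y + y * miyamoto F b x with hm
  have ham : a * m = (2⁻¹ : F) • m := by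
    rw [hm, mul_add, L.half_mul_zero hax hay', L.half_mul_zero hay hax', smul_add]
  have hem : e * m = (2⁻¹ : F) • m := by
    rw [hm, mul_add, mul_comm x, mul_comm y, L.swap.half_mul_zero hey' hex,
      L.swap.half_mul_zero hex' hey, smul_add]
  have hTmm : miyamoto F b m = m := by
    rw [hm, map_add, hTm, hTm, hTT, hTT, mul_comm _ y, mul_comm _ x, add_comm]
  have h1 := L.miyamoto_apply m
  rw [ham, hem, L.form_half ham, L.swap.form_half hem, L.half_mul_half_half ham hem, hTmm,
    L.mid_eq] at h1
  have h3 : m = (2 * B u m) • u := by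
    apply smul_two_cancel h2
    have e1 : (2 : F) • m = m + m := two_smul _ _
    rw [e1]
    nth_rewrite 1 [h1]
    match_scalars <;> field_simp <;> ring
  have h5 : B u m = -(2⁻¹ * B x y) := by
    have e1 : (4 : F) * B u (x * miyamoto F b y) = -B x y := by
      rw [← L.form.assoc, ← hiso, ← smul_eq_mul, ← LinearMap.smul_apply, ← map_smul, hux,
        map_neg, LinearMap.neg_apply]
    have e2 : (4 : F) * B u (y * miyamoto F b x) = -B x y := by
      rw [← L.form.assoc, ← hiso, L.form.symm _ (miyamoto F b y), ← smul_eq_mul,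
        ← LinearMap.smul_apply, ← map_smul, huy, map_neg, LinearMap.neg_apply]
    rw [hm, map_add]
    apply mul_left_cancel₀ h4
    rw [mul_add, e1, e2]
    field_simp
    ring
  rw [h3, h5]
  match_scalars
  field_simp

/-- Here `xy = (x,y)a/2 + r` with `r` annihilated by `a` and `e`; `τ_b` fixes `r` and sends `a` to
`e`. -/
lemma miyamoto_mul_sub (L : OrthoFrame B a e b u) {x y : A} (hax : a * x = (2⁻¹ : F) • x)
    (hex : e * x = 0) (hay : a * y = (2⁻¹ : F) • y) (hey : e * y = 0) :
    x * y - miyamoto F b x * miyamoto F b y = (2⁻¹ * B x y) • (a - e) := by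
  have h2 := L.two
  obtain ⟨p, hp, r, hr, hpr⟩ := Submodule.mem_sup.1
    (L.fst.half_half x (mem_eig.2 hax) y (mem_eig.2 hay))
  rw [L.fst.primitive, Submodule.mem_span_singleton] at hp
  obtain ⟨k, rfl⟩ := hp
  rw [mem_eig, zero_smul] at hr
  have hk : k = 2⁻¹ * B x y := by
    have := L.form.assoc a x y
    rw [← hpr, map_add, map_smul, L.form_zero hr, L.form_self, hax, map_smul] at this
    simpa using this.symm
  have her : e * r = 0 := by
    have := L.swap.zero_mul_zero hex hey
    rwa [← hpr, mul_add, mul_smul_comm, mul_comm e a, L.fst_snd, smul_zero, zero_add] at this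
  have hTr : miyamoto F b r = r := by
    rw [L.miyamoto_apply, hr, her, L.half_mul_zero_zero hr her, L.form_zero hr,
      L.swap.form_zero her, L.form_half_of_half_zero her]
    simp
  rw [← L.mid.toIsAxis.miyamoto_mul h2, ← hpr, map_add, map_smul, L.miyamoto_fst, hTr, hk]
  module

/-- A linear map vanishing on all joint eigenvectors of `a` and `e` is zero. -/
lemma eq_zero_of_peirce (L : OrthoFrame B a e b u) {f : A →ₗ[F] A} (h1 : f a = 0) (h2 : f e = 0)
    (h12 : ∀ x, a * x = (2⁻¹ : F) • x → e * x = (2⁻¹ : F) • x → f x = 0)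
    (h10 : ∀ x, a * x = (2⁻¹ : F) • x → e * x = 0 → f x = 0)
    (h20 : ∀ x, a * x = 0 → e * x = (2⁻¹ : F) • x → f x = 0)
    (h00 : ∀ x, a * x = 0 → e * x = 0 → f x = 0) (x : A) : f x = 0 := by
  have two := L.two
  have split (x : A) : ∃ x0 xh : A, x = B e x • e + x0 + xh ∧ e * x0 = 0 ∧
      e * xh = (2⁻¹ : F) • xh ∧ xh = (2 : F) • (e * x) - (2 * B e x) • e := by
    obtain ⟨p, y, hx, hp, hy⟩ := L.snd.exists_peirce two x
    rw [← L.form.axis e L.snd] at hx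
    refine ⟨p, y, hx, hp, hy, ?_⟩
    nth_rewrite 1 [hx]
    rw [mul_add, mul_add, hp, hy, mul_smul_comm, L.snd.idem]
    match_scalars <;> field_simp <;> ring
  obtain ⟨p, y, hx, hp, hy⟩ := L.fst.exists_peirce two x
  obtain ⟨p0, ph, hpe, hp0, hph, hph'⟩ := split p
  obtain ⟨y0, yh, hye, hy0, hyh, hyh'⟩ := split y
  have haph : a * ph = 0 := by
    rw [hph', mul_sub, mul_smul_comm, L.mul_mul_comm, hp, mul_smul_comm, L.fst_snd]; simp
  have hap0 : a * p0 = 0 := by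
    have : p0 = p - B e p • e - ph := by nth_rewrite 1 [hpe]; abel
    rw [this, mul_sub, mul_sub, hp, haph, mul_smul_comm, L.fst_snd]; simp
  have hBey : B e y = 0 := by rw [L.form.symm]; exact L.form_half_zero hy L.fst_snd
  rw [hBey, zero_smul, zero_add] at hye
  rw [hBey, mul_zero, zero_smul, sub_zero] at hyh'
  have hayh : a * yh = (2⁻¹ : F) • yh := by
    rw [hyh', mul_smul_comm, L.mul_mul_comm, hy, mul_smul_comm, smul_comm]
  have hay0 : a * y0 = (2⁻¹ : F) • y0 := by
    have : y0 = y - yh := by rw [hye]; abel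
    rw [this, mul_sub, hy, hayh, smul_sub]
  rw [hx, hpe, hye]
  simp only [map_add, map_smul, h1, h2, h12 yh hayh hyh, h10 y0 hay0 hy0, h20 ph haph hph,
    h00 p0 hap0 hp0, smul_zero, add_zero]

/-- Polar form, in the directions `a - e` and `u`, of the quadratic part of the multiplicativity
identity. -/
def polar (B : A →ₗ[F] A →ₗ[F] F) (a e u : A) : A →ₗ[F] A →ₗ[F] A :=
  LinearMap.mk₂ F (fun x y => mulQuad B x y (a - e) u + mulQuad B x y u (a - e))
    (by intros; simp only [mulQuad, LinearMap.mk₂_apply, add_mul, mul_add, map_add]; module)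
    (by intros; simp only [mulQuad, LinearMap.mk₂_apply, smul_mul_assoc, mul_smul_comm, map_smul,
          smul_eq_mul]; module)
    (by intros; simp only [mulQuad, LinearMap.mk₂_apply, mul_add, map_add]; module)
    (by intros; simp only [mulQuad, LinearMap.mk₂_apply, mul_smul_comm, map_smul,
          smul_eq_mul]; module)

lemma polar_apply (a e u x y : A) : polar B a e u x y =
    (4 : F) • (((a - e) * x) * (u * y)) - B (a - e) (x * y) • u - B (a - e) x • (u * y)
      - B (a - e) y • (u * x)
    + ((4 : F) • ((u * x) * ((a - e) * y)) - B u (x * y) • (a - e) - B u x • ((a - e) * y)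
      - B u y • ((a - e) * x)) := rfl

lemma polar_comm (x y : A) : polar B a e u x y = polar B a e u y x := by
  rw [polar_apply, polar_apply, mul_comm ((a - e) * x), mul_comm (u * x), mul_comm x y]
  abel

lemma polar_swap (x y : A) : polar B e a u x y = -polar B a e u x y := by
  rw [polar_apply, polar_apply, ← neg_sub a e]
  simp only [neg_mul, mul_neg, map_neg, LinearMap.neg_apply]
  module

lemma polar_of_zero_zero (L : OrthoFrame B a e b u) {x : A} (ha : a * x = 0) (he : e * x = 0)
    (y : A) : polar B a e u x y = 0 := by
  have hw : (a - e) * x = 0 := by rw [sub_mul, ha, he, sub_zero]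
  have hu := L.half_mul_zero_zero ha he
  have h1 : B (a - e) (x * y) = 0 := by rw [← L.form.assoc, hw, map_zero, LinearMap.zero_apply]
  have h2 : B u (x * y) = 0 := by rw [← L.form.assoc, hu, map_zero, LinearMap.zero_apply]
  have h3 : B (a - e) x = 0 := by
    rw [map_sub, LinearMap.sub_apply, L.form_zero ha, L.swap.form_zero he, sub_zero]
  rw [polar_apply, hw, hu, h1, h2, h3, L.form_half_of_half_zero he]
  simp

lemma polar_of_half_half (L : OrthoFrame B a e b u) {x y : A} (hax : a * x = (2⁻¹ : F) • x)
    (hex : e * x = (2⁻¹ : F) • x) (hay : a * y = (2⁻¹ : F) • y) (hey : e * y = (2⁻¹ : F) • y) :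
    polar B a e u x y = 0 := by
  have hw : (a - e) * x = 0 := by rw [sub_mul, hax, hex, sub_self]
  have hw' : (a - e) * y = 0 := by rw [sub_mul, hay, hey, sub_self]
  have hu := L.half_mul_half_half hax hex
  have h1 : B (a - e) (x * y) = 0 := by rw [← L.form.assoc, hw, map_zero, LinearMap.zero_apply]
  have h2 : B u (x * y) = 0 := by
    rw [← L.form.assoc, hu, map_smul, map_add, LinearMap.smul_apply, LinearMap.add_apply,
      L.form_half hay, L.swap.form_half hey, add_zero, smul_zero]
  have h3 : B (a - e) x = 0 := by
    rw [map_sub, LinearMap.sub_apply, L.form_half hax, L.swap.form_half hex, sub_zero]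
  have h4 : B (a - e) y = 0 := by
    rw [map_sub, LinearMap.sub_apply, L.form_half hay, L.swap.form_half hey, sub_zero]
  rw [polar_apply, hw, hw', h1, h2, h3, h4]
  simp

lemma polar_of_half_half_half_zero (L : OrthoFrame B a e b u) {x y : A}
    (hax : a * x = (2⁻¹ : F) • x) (hex : e * x = (2⁻¹ : F) • x) (hay : a * y = (2⁻¹ : F) • y)
    (hey : e * y = 0) : polar B a e u x y = 0 := by
  have two := L.two
  have hw : (a - e) * x = 0 := by rw [sub_mul, hax, hex, sub_self]
  have hw' : (a - e) * y = (2⁻¹ : F) • y := by rw [sub_mul, hay, hey, sub_zero]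
  have hu := L.half_mul_half_half hax hex
  have h1 : B (a - e) (x * y) = 0 := by rw [← L.form.assoc, hw, map_zero, LinearMap.zero_apply]
  have h2 : B u (x * y) = 0 := by
    rw [← L.form.assoc, hu, map_smul, map_add, LinearMap.smul_apply, LinearMap.add_apply,
      L.form_half hay, L.swap.form_zero hey, add_zero, smul_zero]
  have h3 : B (a - e) x = 0 := by
    rw [map_sub, LinearMap.sub_apply, L.form_half hax, L.swap.form_half hex, sub_zero]
  have h4 : B (a - e) y = 0 := by
    rw [map_sub, LinearMap.sub_apply, L.form_half hay, L.swap.form_zero hey, sub_zero]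
  rw [polar_apply, hw, hw', h1, h2, h3, h4, L.form_half_of_half_zero hey, hu]
  simp only [smul_mul_assoc, mul_smul_comm, add_mul, hay, hey, zero_mul, zero_smul]
  match_scalars <;> field_simp <;> ring

/-- Substituting `4ux = -τ_b x` and `4uy = -τ_b y` reduces this to `symm_mul_miyamoto`. -/
lemma polar_of_half_zero_half_zero (L : OrthoFrame B a e b u) {x y : A}
    (hax : a * x = (2⁻¹ : F) • x) (hex : e * x = 0) (hay : a * y = (2⁻¹ : F) • y)
    (hey : e * y = 0) : polar B a e u x y = 0 := by
  have two := L.two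
  have four := four_ne_zero_of_two two
  have hw : (a - e) * x = (2⁻¹ : F) • x := by rw [sub_mul, hax, hex, sub_zero]
  have hw' : (a - e) * y = (2⁻¹ : F) • y := by rw [sub_mul, hay, hey, sub_zero]
  have hux := L.half_mul_half_zero hax hex
  have huy := L.half_mul_half_zero hay hey
  have hax' : a * miyamoto F b x = 0 := by rw [L.mul_miyamoto, hex, map_zero]
  have h1 : B (a - e) (x * y) = 2⁻¹ * B x y := by
    rw [← L.form.assoc, hw, map_smul, LinearMap.smul_apply, smul_eq_mul]
  have h2 : B u (x * y) = 0 := by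
    have : (4 : F) * B u (x * y) = 0 := by
      rw [← L.form.assoc, ← smul_eq_mul, ← LinearMap.smul_apply, ← map_smul, hux, map_neg,
        LinearMap.neg_apply, L.form.symm, L.form_half_zero hay hax', neg_zero]
    exact (mul_eq_zero.1 this).resolve_left four
  have h3 : B (a - e) x = 0 := by
    rw [map_sub, LinearMap.sub_apply, L.form_half hax, L.swap.form_zero hex, sub_zero]
  have h4 : B (a - e) y = 0 := by
    rw [map_sub, LinearMap.sub_apply, L.form_half hay, L.swap.form_zero hey, sub_zero]
  rw [polar_apply, hw, hw', h1, h2, h3, h4, L.form_half_of_half_zero hey,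
    L.form_half_of_half_zero hex]
  have e1 : (4 : F) • ((2⁻¹ : F) • x * (u * y)) = -((2⁻¹ : F) • (x * miyamoto F b y)) := by
    rw [smul_mul_assoc, smul_comm, ← mul_smul_comm, huy, mul_neg, smul_neg]
  have e2 : (4 : F) • ((u * x) * (2⁻¹ : F) • y) = -((2⁻¹ : F) • (y * miyamoto F b x)) := by
    rw [mul_smul_comm, smul_comm, ← smul_mul_assoc, hux, neg_mul, smul_neg, mul_comm y]
  rw [e1, e2]
  have := L.symm_mul_miyamoto hax hex hay hey
  linear_combination (norm := module) -(2⁻¹ : F) • this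

/-- The vector `τ_b y` lies in the joint eigenspace of `x`, so `miyamoto_mul_sub` applies to that
pair. -/
lemma polar_of_half_zero_zero_half (L : OrthoFrame B a e b u) {x y : A}
    (hax : a * x = (2⁻¹ : F) • x) (hex : e * x = 0) (hay : a * y = 0)
    (hey : e * y = (2⁻¹ : F) • y) : polar B a e u x y = 0 := by
  have two := L.two
  have four := four_ne_zero_of_two two
  have hw : (a - e) * x = (2⁻¹ : F) • x := by rw [sub_mul, hax, hex, sub_zero]
  have hw' : (a - e) * y = -((2⁻¹ : F) • y) := by rw [sub_mul, hay, hey, zero_sub]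
  have hux := L.half_mul_half_zero hax hex
  have huy := L.swap.half_mul_half_zero hey hay
  have haTy : a * miyamoto F b y = (2⁻¹ : F) • miyamoto F b y := by
    rw [L.mul_miyamoto, hey, map_smul]
  have heTy : e * miyamoto F b y = 0 := by rw [L.swap.mul_miyamoto, hay, map_zero]
  have hTT := L.mid.toIsAxis.miyamoto_miyamoto two
  have hsub := L.miyamoto_mul_sub hax hex haTy heTy
  rw [hTT] at hsub
  have h1 : B (a - e) (x * y) = 0 := by
    rw [← L.form.assoc, hw, map_smul, LinearMap.smul_apply, L.form_half_zero hax hay, smul_zero]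
  have h2 : B u (x * y) = -(4⁻¹ * B x (miyamoto F b y)) := by
    have : (4 : F) * B u (x * y) = -B x (miyamoto F b y) := by
      rw [← L.miyamoto_isometry x, hTT, ← L.form.assoc, ← smul_eq_mul, ← LinearMap.smul_apply,
        ← map_smul, hux, map_neg, LinearMap.neg_apply]
    apply mul_left_cancel₀ four
    rw [this]
    field_simp
  have h3 : B (a - e) x = 0 := by
    rw [map_sub, LinearMap.sub_apply, L.form_half hax, L.swap.form_zero hex, sub_zero]
  have h4 : B (a - e) y = 0 := by
    rw [map_sub, LinearMap.sub_apply, L.form_zero hay, L.swap.form_half hey, sub_zero]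
  rw [polar_apply, hw, hw', h1, h2, h3, h4, L.swap.form_half_of_half_zero hay,
    L.form_half_of_half_zero hex]
  have e1 : (4 : F) • ((2⁻¹ : F) • x * (u * y)) = -((2⁻¹ : F) • (x * miyamoto F b y)) := by
    rw [smul_mul_assoc, smul_comm, ← mul_smul_comm, huy, mul_neg, smul_neg]
  have e2 : (4 : F) • ((u * x) * -((2⁻¹ : F) • y)) = (2⁻¹ : F) • (miyamoto F b x * y) := by
    rw [mul_neg, smul_neg, mul_smul_comm, smul_comm, ← smul_mul_assoc, hux, neg_mul, smul_neg,
      neg_neg]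
  rw [e1, e2]
  have e3 : miyamoto F b x * y = x * miyamoto F b y
      - (2⁻¹ * B x (miyamoto F b y)) • (a - e) := by rw [← hsub]; abel
  rw [e3]
  have e4 : (4 : F)⁻¹ = 2⁻¹ * 2⁻¹ := by rw [← mul_inv]; norm_num
  rw [e4]
  module

lemma polar_of_fst (L : OrthoFrame B a e b u) (y : A) : polar B a e u a y = 0 := by
  have two := L.two
  have four := four_ne_zero_of_two two
  have hua : u * a = (2⁻¹ : F) • u := by rw [mul_comm, L.fst_half]
  have hue : u * e = (2⁻¹ : F) • u := by rw [mul_comm, L.snd_half]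
  have hea : e * a = 0 := by rw [mul_comm, L.fst_snd]
  have hBae : B a e = 0 := L.form_zero L.fst_snd
  have hBea : B e a = 0 := L.swap.form_zero hea
  have hBau : B a u = 0 := L.form_half L.fst_half
  have hBua : B u a = 0 := by rw [L.form.symm, hBau]
  have hBue : B u e = 0 := by rw [L.form.symm, L.swap.form_half L.snd_half]
  have hwa : (a - e) * a = a := by rw [sub_mul, L.fst.idem, hea, sub_zero]
  have hwe : (a - e) * e = -e := by rw [sub_mul, L.snd.idem, L.fst_snd, zero_sub]
  have h1 (y : A) : B (a - e) (a * y) = B a y := by rw [← L.form.assoc, hwa]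
  have h2 (y : A) : B u (a * y) = 2⁻¹ * B u y := by
    rw [← L.form.assoc, hua, map_smul, LinearMap.smul_apply, smul_eq_mul]
  have h3 : B (a - e) a = 1 := by
    rw [map_sub, LinearMap.sub_apply, L.form_self, hBea, sub_zero]
  have expand (y : A) : polar B a e u a y = (4 : F) • (a * (u * y)) - B a y • u - u * y
      - (2⁻¹ * (B a y - B e y)) • u + ((2 : F) • (u * ((a - e) * y)) - (2⁻¹ * B u y) • (a - e)
      - B u y • a) := by
    rw [polar_apply, hwa, hua, h1, h2, h3, hBua, map_sub, LinearMap.sub_apply, smul_mul_assoc]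
    match_scalars <;> field_simp <;> ring
  refine L.eq_zero_of_peirce (f := polar B a e u a) ?_ ?_ (fun y ha he => ?_) (fun y ha he => ?_)
    (fun y ha he => ?_) (fun y ha he => ?_) y
  · rw [expand, hua, mul_smul_comm, L.fst_half, hwa, hua, L.form_self, hBea, hBua]
    match_scalars <;> field_simp <;> ring
  · rw [expand, hue, mul_smul_comm, L.fst_half, hwe, mul_neg, hue, hBae, L.swap.form_self, hBue]
    match_scalars <;> field_simp <;> ring
  · have hw : (a - e) * y = 0 := by rw [sub_mul, ha, he, sub_self]
    rw [expand, hw, L.half_mul_half_half ha he, L.form_half ha, L.swap.form_half he,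
      mul_smul_comm, mul_add, L.fst.idem, L.fst_snd, mul_zero]
    match_scalars <;> field_simp <;> ring
  · have hw : (a - e) * y = (2⁻¹ : F) • y := by rw [sub_mul, ha, he, sub_zero]
    have : (4 : F) • (a * (u * y)) = 0 := by
      rw [← mul_smul_comm, L.half_mul_half_zero ha he, mul_neg, L.mul_miyamoto, he, map_zero,
        neg_zero]
    rw [expand, hw, this, L.form_half ha, L.swap.form_zero he, L.form_half_of_half_zero he,
      mul_smul_comm]
    match_scalars <;> field_simp <;> ring
  · have hw : (a - e) * y = -((2⁻¹ : F) • y) := by rw [sub_mul, ha, he, zero_sub]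
    have : (4 : F) • (a * (u * y)) = (2 : F) • (u * y) := by
      have h5 := L.swap.half_mul_half_zero he ha
      rw [← mul_smul_comm, h5, mul_neg, L.mul_miyamoto, he, map_smul, ← smul_neg, ← h5]
      match_scalars
      field_simp
      ring
    rw [expand, hw, this, L.form_zero ha, L.swap.form_half he, L.swap.form_half_of_half_zero ha,
      mul_neg, mul_smul_comm]
    match_scalars <;> field_simp <;> ring
  · rw [polar_comm, L.polar_of_zero_zero ha he]

lemma polar_eq_zero (L : OrthoFrame B a e b u) (x y : A) : polar B a e u x y = 0 := by
  have sw {x y : A} (h : polar B e a u x y = 0) : polar B a e u x y = 0 := by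
    rwa [polar_swap, neg_eq_zero] at h
  have cm {x y : A} (h : polar B a e u x y = 0) : polar B a e u y x = 0 := by
    rwa [polar_comm]
  have h1 := L.polar_of_fst
  have h2 (y : A) : polar B a e u e y = 0 := sw (L.swap.polar_of_fst y)
  refine L.eq_zero_of_peirce (f := (polar B a e u).flip y) (h1 y) (h2 y) (fun x ha he => ?_)
    (fun x ha he => ?_) (fun x ha he => ?_) (fun x ha he => L.polar_of_zero_zero ha he y) x
  · exact L.eq_zero_of_peirce (f := polar B a e u x) (cm (h1 x)) (cm (h2 x))
      (fun y ha' he' => L.polar_of_half_half ha he ha' he')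
      (fun y ha' he' => L.polar_of_half_half_half_zero ha he ha' he')
      (fun y ha' he' => sw (L.swap.polar_of_half_half_half_zero he ha he' ha'))
      (fun y ha' he' => cm (L.polar_of_zero_zero ha' he' x)) y
  · exact L.eq_zero_of_peirce (f := polar B a e u x) (cm (h1 x)) (cm (h2 x))
      (fun y ha' he' => cm (L.polar_of_half_half_half_zero ha' he' ha he))
      (fun y ha' he' => L.polar_of_half_zero_half_zero ha he ha' he')
      (fun y ha' he' => L.polar_of_half_zero_zero_half ha he ha' he')
      (fun y ha' he' => cm (L.polar_of_zero_zero ha' he' x)) y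
  · exact L.eq_zero_of_peirce (f := polar B a e u x) (cm (h1 x)) (cm (h2 x))
      (fun y ha' he' => cm (sw (L.swap.polar_of_half_half_half_zero he' ha' he ha)))
      (fun y ha' he' => cm (L.polar_of_half_zero_zero_half ha' he' ha he))
      (fun y ha' he' => sw (L.swap.polar_of_half_zero_half_zero he ha he' ha'))
      (fun y ha' he' => cm (L.polar_of_zero_zero ha' he' x)) y

end OrthoFrame

/-- The axis `τ_b a = 2z` sits at `(2, 0)`, so it yields no second symmetric pair. But it is
orthogonal to `a`, and `p` is a multiple of `a - 2z`, so `polar_eq_zero` kills the polar term of `p`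
and `u`. -/
lemma LineFrame.isDerivation_of_half {B : A →ₗ[F] A →ₗ[F] F} {a b z u : A} {α : F}
    (L : LineFrame B a b z u α) (hα : 2 * α = 1) : IsDerivation (D F a b) := by
  have h2 := L.two
  obtain rfl : α = 2⁻¹ := eq_inv_of_mul_eq_one_right hα
  have he : miyamoto F b a = (2 : F) • z := by
    rw [L.miyamoto_snd_fst]
    match_scalars <;> field_simp <;> ring
  have hpe : IsPrimitiveAxis F ((2 : F) • z) := he ▸ L.fst.miyamoto h2 L.snd.toIsAxis
  have O : OrthoFrame B a ((2 : F) • z) b u := by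
    refine ⟨L.form, h2, L.fst, hpe, L.snd, by rw [mul_smul_comm, L.fst_zero, smul_zero],
      L.fst_half, ?_, ?_⟩
    · rw [smul_mul_assoc, L.zero_half]
      match_scalars
      field_simp
      ring
    · rw [smul_add, smul_comm, half_add_half h2]
      exact L.snd_eq
  apply L.isDerivation_of_deriv
  intro x y
  have hb := (L.form.axisIdentities h2 L.snd).2 x y
  have hb' := (L.form.axisIdentities h2 (L.snd.miyamoto h2 L.fst.toIsAxis)).2 x y
  have eb := L.miyamoto_fst 1 1
  rw [one_smul, one_smul, L.snd_eq'] at eb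
  rw [eb] at hb'
  rw [← L.snd_eq'] at hb
  have hw : mulQuad B x y (a - (2 : F) • z) u + mulQuad B x y u (a - (2 : F) • z) = 0 :=
    O.polar_eq_zero x y
  have hp : z - (1 - (2⁻¹ : F)) • a = (-2⁻¹ : F) • (a - (2 : F) • z) := by
    match_scalars <;> field_simp
    ring
  refine quadDeriv_eq_zero_of_polar h2 ?_ hb hb'
  rw [hp, map_smul, map_smul, LinearMap.smul_apply, ← smul_add, hw, smul_zero]

end Orthogonal

end JordanHalf

/-! ### Assembly of the cases. -/

theorem mainTheorem3 {F A : Type*} [Field F] [NonUnitalNonAssocCommRing A] [Module F A]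
    [SMulCommClass F A A] [IsScalarTower F A A] (hF : ringChar F ≠ 2)
    (X : Set A) (hX : JordanHalf.IsPrimitiveAxialAlgebra F X)
    (a b : A) (ha : a ∈ X) (hb : b ∈ X) :
    (JordanHalf.IsDerivation (JordanHalf.D F a b) → JordanHalf.IsSolid F a b) ∧
    (Nat.card F ≠ 3 →
      (JordanHalf.IsSolid F a b ↔ JordanHalf.IsDerivation (JordanHalf.D F a b))) := by
  have h2 : (2 : F) ≠ 0 := Ring.two_ne_zero hF
  obtain ⟨B, hB⟩ := hX.exists_frobeniusForm h2
  have pa := hX.axis a ha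
  have pb := hX.axis b hb
  obtain ⟨z, u, hx, hz, hu, hzz, hzu, huu⟩ := pa.exists_line h2 pb
  have L : JordanHalf.LineFrame B a b z u (JordanHalf.coord F a b) :=
    ⟨hB, h2, pa, pb, hx, hz, hu, hzz, hzu, huu, hB.axis a pa b⟩
  refine ⟨L.isSolid_of_isDerivation, fun hcard => ⟨fun hs => ?_, L.isSolid_of_isDerivation⟩⟩
  generalize JordanHalf.coord F a b = α at L
  by_cases h1 : 2 * α = 1
  · exact L.isDerivation_of_half h1
  by_cases h4 : 4 * α = 1
  swap
  · exact L.isDerivation_of_generic h1 h4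
  by_cases hα : 1 - α = 0
  swap
  · exact L.isDerivation_of_quarter h4 hα hs
  obtain rfl : α = 1 := (sub_eq_zero.1 hα).symm
  -- If every nonzero `r` had `r² = 1`, the field would be `{0, 1, -1}`. Infinite fields are
  -- admitted by the hypothesis, their `Nat.card` being `0`.
  have hr : ∃ r : F, r ≠ 0 ∧ r ^ 2 ≠ 1 := by
    by_contra! hcon
    apply hcard
    have huniv : (Set.univ : Set F) = {0, 1, -1} := by
      ext r
      simp only [Set.mem_univ, Set.mem_insert_iff, Set.mem_singleton_iff, true_iff]
      by_cases hr : r = 0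
      · exact Or.inl hr
      · exact Or.inr (sq_eq_one_iff.1 (hcon r hr))
    rw [← Set.ncard_univ, huniv, Set.ncard_eq_three]
    refine ⟨0, 1, -1, zero_ne_one, fun h => ?_, fun h => h2 ?_, rfl⟩
    · exact one_ne_zero (neg_eq_zero.1 h.symm)
    · linear_combination h
  obtain ⟨r, hr, hr1⟩ := hr
  exact L.isDerivation_of_one hr hr1 hs
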